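/- Let $k$ be a field, $A$ a commutative $k$-algebra and $\mathfrak m\subset A$ a maximal ideal such that $k\to A/\mathfrak m$ is an isomorphism. Put $M=A/\mathfrak m$ and assume that $\mathrm{Ext}^1_A(M,M)$ is finite dimensional over $k$. Let $C^i=\mathrm{Hom}_k(A^{\otimes i},\mathrm{End}_k(M))$ be the Hochschild cochains of $A$ with values in $\mathrm{End}_k(M)$, where $M$ is a right $A$-module with structure morphism $\rho(a)(m)=ma$. So $(d\theta)(a)=\rho(a)\theta-\theta\rho(a)$ on $C^0$, $(d\varphi)(a\otimes b)=\varphi(b)\rho(a)-\varphi(ab)+\rho(b)\varphi(a)$ on $C^1$, and $(\varphi\cup\psi)(a\otimes b)=\psi(b)\varphi(a)$ for $\varphi,\psi\in C^1$. Here $\mathrm{Ext}^1_A(M,M)=\ker(d\colon C^1\to C^2)/d(C^0)$. Choose cocycles $x_1,\dots,x_n\in C^1$ whose classes form a basis of $\mathrm{Ext}^1_A(M,M)$, and a basis $(y_i)_{i\in I}$ of $C^2/dC^1$. The formal algebra $\hat H(M)$ is constructed as follows. Let $\mathfrak n=(x_1,\dots,x_n)$ be the augmentation ideal of the free associative algebra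 $k\langle x_1,\dots,x_n\rangle$ (whose variables are also called $x_1,\dots,x_n$). Put $J_0=\mathfrak n$, $J_1=\mathfrak n^2$, $\bar B_0=\{1\}$, $\bar B_1=\{1,x_1,\dots,x_n\}$, and let $v_{x_j}\in C^1$ be the chosen cocycle $x_j$. Given the two-sided ideal $J_N$ ($N\ge1$), a set $\bar B_N$ of monomials that is a basis of $\bar H_N=k\langle x_1,\dots,x_n\rangle/J_N$, and elements $v_t\in C^1$ for $1\ne t\in\bar B_N$, let $J_{N+1}$ be the two-sided ideal generated by $\mathfrak nJ_N$, $J_N\mathfrak n$ and all $$f_i^{N+1}=\sum_{t_1,t_2\in\bar B_N\setminus\{1\}}y_i^*(v_{t_1}\cup v_{t_2})\,t_1t_2 ,\qquad i\in I .$$ Enlarge $\bar B_N$ by monomials in $J_N$ to a basis $\bar B_{N+1}$ of $\bar H_{N+1}=k\langle x_1,\dots,x_n\rangle/J_{N+1}$, and for each $u\in\bar B_{N+1}\setminus\bar B_N$ choose $v_u\in C^1$ with $$d(v_u)=-\sum_{t_1,t_2\in\bar B_N\setminus\{1\}}\beta_{t_1t_2,u}\,v_{t_1}\cup v_{t_2},$$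 where $t_1t_2=\sum_{u\in\bar B_{N+1}}\beta_{t_1t_2,u}\,u$ in $\bar H_{N+1}$. Then $\hat H(M)=\varprojlim_N\bar H_N$, and the completion of $A$ in $M$ is $\hat A_M=\mathrm{End}_{\hat H(M)}\bigl(\hat H(M)\otimes_kM\bigr)$. **Proposition.** Cocycles $x_1,\dots,x_n$ as above exist, and for each choice of them the construction can be carried out. For all choices made in it, the algebra $\hat A_M$, and likewise $\hat H(M)$ itself, is isomorphic as a $k$-algebra to the $\mathfrak m$-adic completion $\hat A_{\mathfrak m}=\varprojlim_N A/\mathfrak m^N$. -/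

import Mathlib

open scoped TensorProduct

noncomputable section

/-- A GMMP-algebra over `k`: vector spaces `V`, `W` with linear maps `∪ : V ⊗ V → W` and
`d : V → W`. -/
structure GMMPAlgebra (k V W : Type*) [Field k] [AddCommGroup V] [Module k V]
    [AddCommGroup W] [Module k W] where
  cup : V ⊗[k] V →ₗ[k] W
  d : V →ₗ[k] W

/-- The first cohomology `ker d¹ / im d⁰` of a complex `U → V → W` of vector spaces. -/
abbrev firstCohomology {k U V W : Type*} [Field k] [AddCommGroup U] [Module k U]
    [AddCommGroup V] [Module k V] [AddCommGroup W] [Module k W]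
    (d0 : U →ₗ[k] V) (d1 : V →ₗ[k] W) : Type _ :=
  LinearMap.ker d1 ⧸ (LinearMap.range d0).comap (LinearMap.ker d1).subtype

/-- The class of a cocycle. -/
abbrev cocycleClass {k U V W : Type*} [Field k] [AddCommGroup U] [Module k U]
    [AddCommGroup V] [Module k V] [AddCommGroup W] [Module k W]
    (d0 : U →ₗ[k] V) (d1 : V →ₗ[k] W) (x : V) (hx : d1 x = 0) : firstCohomology d0 d1 :=
  Submodule.Quotient.mk ⟨x, hx⟩

/-! ### The Hochschild complex of an algebra with values in the endomorphisms of a right module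

`A` is an associative `k`-algebra and `M` a right `A`-module, that is a module over `Aᵐᵒᵖ`. -/

namespace Hochschild

section

variable (k A M : Type*) [Field k] [Ring A] [Algebra k A] [AddCommGroup M] [Module k M]
  [Module Aᵐᵒᵖ M] [IsScalarTower k Aᵐᵒᵖ M]

/-- The structure morphism `ρ(a)(m) = m a`; it satisfies `ρ(a b) = ρ(b) ∘ ρ(a)`. -/
def rho : A →ₗ[k] Module.End k M :=
  (Algebra.lsmul k k M : Aᵐᵒᵖ →ₐ[k] Module.End k M).toLinearMap ∘ₗ
    (MulOpposite.opLinearEquiv k : A ≃ₗ[k] Aᵐᵒᵖ).toLinearMap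

theorem rho_apply (a : A) (x : M) : rho k A M a x = MulOpposite.op a • x := rfl

theorem rho_mul (a b : A) : rho k A M (a * b) = rho k A M b * rho k A M a := by
  ext x
  simp [rho_apply, mul_smul]

/-- Hochschild `1`-cochains. (The `0`-cochains are `Module.End k M`.) -/
abbrev C1 : Type _ := A →ₗ[k] Module.End k M

/-- Hochschild `2`-cochains. -/
abbrev C2 : Type _ := A ⊗[k] A →ₗ[k] Module.End k M

/-- `(d⁰ θ)(a) = ρ(a) ∘ θ - θ ∘ ρ(a)`. -/
def d0 : Module.End k M →ₗ[k] C1 k A M :=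
  LinearMap.mk₂ k (fun θ a => rho k A M a * θ - θ * rho k A M a)
    (fun _ _ _ => by simp only [mul_add, add_mul]; abel)
    (fun _ _ _ => by simp only [mul_smul_comm, smul_mul_assoc, smul_sub])
    (fun _ _ _ => by simp only [map_add, mul_add, add_mul]; abel)
    (fun _ _ _ => by simp only [map_smul, mul_smul_comm, smul_mul_assoc, smul_sub])

/-- `(d¹ φ)(a ⊗ b) = φ(b) ∘ ρ(a) - φ(a b) + ρ(b) ∘ φ(a)`. -/
def d1 : C1 k A M →ₗ[k] C2 k A M where
  toFun φ := TensorProduct.lift <|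
    LinearMap.mk₂ k (fun a b => φ b * rho k A M a - φ (a * b) + rho k A M b * φ a)
      (fun _ _ _ => by simp only [map_add, mul_add, add_mul]; abel)
      (fun _ _ _ => by simp only [map_smul, mul_smul_comm, smul_mul_assoc, smul_sub, smul_add])
      (fun _ _ _ => by simp only [map_add, mul_add, add_mul]; abel)
      (fun _ _ _ => by simp only [map_smul, mul_smul_comm, smul_mul_assoc, smul_sub, smul_add])
  map_add' φ ψ := by
    refine TensorProduct.ext' fun a b => ?_
    simp only [TensorProduct.lift.tmul, LinearMap.mk₂_apply, LinearMap.add_apply, mul_add, add_mul]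
    abel
  map_smul' c φ := by
    refine TensorProduct.ext' fun a b => ?_
    simp only [TensorProduct.lift.tmul, LinearMap.mk₂_apply, LinearMap.smul_apply, mul_smul_comm,
      smul_mul_assoc, smul_sub, smul_add, RingHom.id_apply]

theorem d1_tmul (φ : C1 k A M) (a b : A) :
    d1 k A M φ (a ⊗ₜ[k] b) = φ b * rho k A M a - φ (a * b) + rho k A M b * φ a := rfl

theorem d1_d0 (θ : Module.End k M) : d1 k A M (d0 k A M θ) = 0 := by
  refine TensorProduct.ext' fun a b => ?_
  simp only [d1_tmul, d0, LinearMap.mk₂_apply, rho_mul, LinearMap.zero_apply, mul_sub, sub_mul,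
    mul_assoc]
  abel

/-- The cup product of `1`-cochains, `(φ ∪ ψ)(a ⊗ b) = ψ(b) ∘ φ(a)`: first `φ(a)`, then `ψ(b)`,
as is right for right modules. -/
def cup : C1 k A M ⊗[k] C1 k A M →ₗ[k] C2 k A M :=
  TensorProduct.lift <| LinearMap.mk₂ k
    (fun φ ψ => TensorProduct.lift <| LinearMap.mk₂ k (fun a b => ψ b * φ a)
      (fun _ _ _ => by simp only [map_add, mul_add])
      (fun _ _ _ => by simp only [map_smul, mul_smul_comm])
      (fun _ _ _ => by simp only [map_add, add_mul])
      (fun _ _ _ => by simp only [map_smul, smul_mul_assoc]))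
    (fun _ _ _ => by
      refine TensorProduct.ext' fun a b => ?_
      simp only [TensorProduct.lift.tmul, LinearMap.mk₂_apply, LinearMap.add_apply, mul_add])
    (fun _ _ _ => by
      refine TensorProduct.ext' fun a b => ?_
      simp only [TensorProduct.lift.tmul, LinearMap.mk₂_apply, LinearMap.smul_apply,
        mul_smul_comm])
    (fun _ _ _ => by
      refine TensorProduct.ext' fun a b => ?_
      simp only [TensorProduct.lift.tmul, LinearMap.mk₂_apply, LinearMap.add_apply, add_mul])
    (fun _ _ _ => by
      refine TensorProduct.ext' fun a b => ?_
      simp only [TensorProduct.lift.tmul, LinearMap.mk₂_apply, LinearMap.smul_apply,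
        smul_mul_assoc])

theorem cup_tmul_tmul (φ ψ : C1 k A M) (a b : A) :
    cup k A M (φ ⊗ₜ[k] ψ) (a ⊗ₜ[k] b) = ψ b * φ a := rfl

/-- The GMMP-algebra `(C¹(A, M), C²(A, M), ∪, d)`. -/
def gmmp : GMMPAlgebra k (C1 k A M) (C2 k A M) where
  cup := cup k A M
  d := d1 k A M

/-- `H¹ = ker d¹ / im d⁰`, that is `Ext¹_A(M, M)`. -/
abbrev Ext1 : Type _ := firstCohomology (d0 k A M) (d1 k A M)

/-- `x₁, …, xₙ` are cocycles in `C¹(A, M)` whose classes form a basis of `Ext¹_A(M, M)`. -/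
def IsExtBasis {n : ℕ} (x : Fin n → C1 k A M) : Prop :=
  ∃ (hx : ∀ i, d1 k A M (x i) = 0) (b : Module.Basis (Fin n) k (Ext1 k A M)),
    ∀ i, b i = cocycleClass (d0 k A M) (d1 k A M) (x i) (hx i)

end

end Hochschild

/-! ### The formal algebra of a GMMP-algebra with respect to `x₁, …, xₙ ∈ V` -/

namespace GMMPAlgebra

section

instance decidableEqWord (n : ℕ) : DecidableEq (FreeMonoid (Fin n)) :=
  inferInstanceAs (DecidableEq (List (Fin n)))

variable {k V W : Type*} [Field k] [AddCommGroup V] [Module k V] [AddCommGroup W] [Module k W]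

variable (k) in
/-- The monomial of a word in the free associative algebra `k⟨x₁, …, xₙ⟩`. -/
def mon {n : ℕ} : FreeMonoid (Fin n) →* FreeAlgebra k (Fin n) :=
  FreeMonoid.lift (FreeAlgebra.ι k)

variable (k) in
/-- The kernel `𝔪` of the augmentation `k⟨x₁, …, xₙ⟩ → k`, `xᵢ ↦ 0`. -/
def augIdeal (n : ℕ) : TwoSidedIdeal (FreeAlgebra k (Fin n)) :=
  TwoSidedIdeal.ker (FreeAlgebra.lift k (fun _ : Fin n => (0 : k)))

variable (L : GMMPAlgebra k V W) {n : ℕ}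

/-- The sum over `t₁, t₂ ∈ B \ {1}` of `yᵢ*(v_{t₁} ∪ v_{t₂}) t₁ t₂`, where `(yᵢ)` is a basis of
`W / im d`. -/
def relationPoly {I : Set (W ⧸ LinearMap.range L.d)}
    (y : Module.Basis I k (W ⧸ LinearMap.range L.d))
    (B : Finset (FreeMonoid (Fin n))) (v : FreeMonoid (Fin n) → V) (i : I) :
    FreeAlgebra k (Fin n) :=
  ∑ t₁ ∈ B.erase 1, ∑ t₂ ∈ B.erase 1,
    y.coord i (Submodule.Quotient.mk (L.cup (v t₁ ⊗ₜ[k] v t₂))) • mon k (t₁ * t₂)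

/-- The ideals `J_N` of `k⟨x₁, …, xₙ⟩` with `H̄_N = k⟨x₁, …, xₙ⟩ / J_N`. One has `J₀ = 𝔪`, and
`J_{N+1}` is generated by `𝔪 J_N`, `J_N 𝔪` and the relations `fᵢ^{N+1}` of stage `N + 1`. Since
`J_N = 𝔪^{N+1} + (fᵢ^N)`, here `𝔪 J_N + J_N 𝔪 = 𝔪^{N+2} + 𝔪 (fᵢ^N) + (fᵢ^N) 𝔪`. For `N = 0`
there are no relations and `J₁ = 𝔪²`. -/
def stageIdeal {I : Set (W ⧸ LinearMap.range L.d)}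
    (y : Module.Basis I k (W ⧸ LinearMap.range L.d))
    (B : ℕ → Finset (FreeMonoid (Fin n))) (v : FreeMonoid (Fin n) → V) :
    ℕ → TwoSidedIdeal (FreeAlgebra k (Fin n))
  | 0 => augIdeal k n
  | N + 1 => TwoSidedIdeal.span
      ({p | ∃ a ∈ augIdeal k n, ∃ b ∈ stageIdeal y B v N, p = a * b ∨ p = b * a} ∪
        Set.range (L.relationPoly y (B N) v))

/-- All the choices in the inductive construction of the formal algebra of `L` with respect to
`x₁, …, xₙ ∈ V`: a basis of `W / im d`, the monomial bases `B̄_N` of `H̄_N` and the elements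
`v_u ∈ V`. -/
structure MasseyData (L : GMMPAlgebra k V W) {n : ℕ} (x : Fin n → V) where
  /-- The index set of the chosen basis of `W / im d`. -/
  I : Set (W ⧸ LinearMap.range L.d)
  /-- The chosen basis of `W / im d`. -/
  y : Module.Basis I k (W ⧸ LinearMap.range L.d)
  /-- The set of words `B̄_N`. -/
  B : ℕ → Finset (FreeMonoid (Fin n))
  /-- The elements `v_u`; only the words `u ≠ 1` in some `B̄_N` matter. -/
  v : FreeMonoid (Fin n) → V
  B_zero : B 0 = {1}
  B_one : B 1 = insert 1 (Finset.univ.image FreeMonoid.of)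
  B_mono : ∀ N, B N ⊆ B (N + 1)
  /-- The new monomials `B_{N+1}` lie in the kernel of `H̄_{N+1} → H̄_N`. -/
  B_new : ∀ N, ∀ u ∈ B (N + 1) \ B N, mon k u ∈ L.stageIdeal y B v N
  /-- `B̄_N` is a basis of `H̄_N`. -/
  basis : ∀ N, Module.Basis (B N) k (L.stageIdeal y B v N).ringCon.Quotient
  basis_apply : ∀ N (u : B N), basis N u = (L.stageIdeal y B v N).ringCon.mkₐ k (mon k u.1)
  v_of : ∀ i, v (FreeMonoid.of i) = x i
  /-- `d(v_u) = - ∑ β v_{t₁} ∪ v_{t₂}`, where `β` is the coefficient of `t₁ t₂` at `u` in the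
  basis `B̄_{N+1}` of `H̄_{N+1}`, and `t₁, t₂` run over `B̄_N \ {1}`. -/
  d_v : ∀ N, 1 ≤ N → ∀ u : B (N + 1), u.1 ∉ B N →
    L.d (v u.1) = - ∑ t₁ ∈ (B N).erase 1, ∑ t₂ ∈ (B N).erase 1,
      (basis (N + 1)).repr ((L.stageIdeal y B v (N + 1)).ringCon.mkₐ k (mon k (t₁ * t₂))) u •
        L.cup (v t₁ ⊗ₜ[k] v t₂)

namespace MasseyData

variable {L} {x : Fin n → V} (R : MasseyData L x)

/-- The finite dimensional algebra `H̄_N` of stage `N`. -/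
abbrev stage (N : ℕ) : Type _ := (L.stageIdeal R.y R.B R.v N).ringCon.Quotient

/-- The class in `H̄_N` of an element of `k⟨x₁, …, xₙ⟩`. -/
abbrev toStage (N : ℕ) : FreeAlgebra k (Fin n) →ₐ[k] R.stage N :=
  (L.stageIdeal R.y R.B R.v N).ringCon.mkₐ k

/-- The formal algebra of `L` with respect to `x₁, …, xₙ`: the inverse limit of the `H̄_N`. The
transition map `H̄_{N+1} → H̄_N` takes the class of `p ∈ k⟨x₁, …, xₙ⟩` to the class of `p`. -/
def formalAlgebra : Subalgebra k (∀ N, R.stage N) where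
  carrier := {h | ∀ N, ∃ p : FreeAlgebra k (Fin n),
    R.toStage (N + 1) p = h (N + 1) ∧ R.toStage N p = h N}
  mul_mem' := by
    intro a b ha hb N
    obtain ⟨p, hp, hp'⟩ := ha N
    obtain ⟨q, hq, hq'⟩ := hb N
    exact ⟨p * q, by rw [map_mul, hp, hq]; rfl, by rw [map_mul, hp', hq']; rfl⟩
  add_mem' := by
    intro a b ha hb N
    obtain ⟨p, hp, hp'⟩ := ha N
    obtain ⟨q, hq, hq'⟩ := hb N
    exact ⟨p + q, by rw [map_add, hp, hq]; rfl, by rw [map_add, hp', hq']; rfl⟩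
  algebraMap_mem' := by
    intro c N
    exact ⟨algebraMap k _ c, by rw [AlgHom.commutes]; rfl, by rw [AlgHom.commutes]; rfl⟩

end MasseyData

end

end GMMPAlgebra

/-- The completion of `A` in the right module `M` (one module, `r = 1`): the algebra of
`Ĥ`-linear endomorphisms of the left `Ĥ`-module `Ĥ ⊗_k M`, where `Ĥ = Ĥ(M)` is the formal algebra
of the Hochschild GMMP-algebra with respect to representatives `x` of a basis of
`Ext¹_A(M, M)`, computed with the choices `R`. -/
abbrev moduleCompletion {k A M : Type*} [Field k] [Ring A] [Algebra k A] [AddCommGroup M]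
    [Module k M] [Module Aᵐᵒᵖ M] [IsScalarTower k Aᵐᵒᵖ M] {n : ℕ}
    {x : Fin n → Hochschild.C1 k A M}
    (R : GMMPAlgebra.MasseyData (Hochschild.gmmp k A M) x) : Type _ :=
  Module.End R.formalAlgebra (R.formalAlgebra ⊗[k] M)

end

/-! Write `𝔫` for the augmentation ideal of the free algebra and `ε : A → k` for reduction modulo
`𝔪`. As `A/𝔪 ≅ k`, cochains are `k`-valued and `d⁰ = 0`. The `v_t` assemble to maps `φ_N : A →
H̄_N`, `a ↦ ε(a) + ∑ v_t(a) t`, and the equations for `d(v_u)` say that `φ_N` is multiplicative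
(`coef_mul`, `toStage_versalPoly_mul`). The point is that `φ_N` is surjective with kernel `𝔪^{N+1}`.
In the limit `Ĥ` is the completion of `A`; since `Ĥ ⊗ A/𝔪` is free of rank one, its endomorphism
algebra is `Ĥᵐᵒᵖ`, which is `Ĥ` by commutativity.

Surjectivity (`exists_versalHom_eq_ι`): preimages of the variables under `φ_N` define `g : k⟨x⟩ →
A`. Then `φ_{N+1} ∘ g` is the projection up to `J_N`, and is exactly the projection on `𝔫²`, because
errors of products lie in `𝔫 J_N + J_N 𝔫`. For `N ≥ 1` the error at a variable lies in `J_N ⊆ 𝔫²`,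
so it can be corrected.

Kernel (`mem_pow_of_versalHom_eq_zero`): let `g` lift the variables along `φ_{N+1}`, `N ≥ 1`. An
element of `𝔪^{N+1}` is some `g(p)` modulo `𝔪^{N+2}`; if `φ_{N+1}` kills it, then `p ∈ J_{N+1}`, so
it suffices that `g(J_{N+1}) ⊆ 𝔪^{N+2}`. The essential generators are the relations
(`lift_relationPoly_mem`): a functional `l` killing `𝔪^{N+2}` yields a cochain with coboundary `-∑
l(g(st)) v_s ∪ v_t`, and applying `yᵢ*` gives `l(g(fᵢ)) = 0`. The case of `φ_1` is the duality
between `Ext¹` and `𝔪/𝔪²`.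

The choices exist over any GMMP-algebra. Modulo `J_{N+1}`, every element of `J_N` is a combination
of monomials in `J_N` (`IsAdmissible`), so monomial bases extend; the equation for `v_u` is solvable
because the `fᵢ` vanish in `H̄_{N+1}` (`exists_d_eq`). -/

noncomputable section

/-! ### Two-sided ideals of the free algebra and the monomials in them. -/

namespace GMMPAlgebra

section FreeAlgebraIdeals

variable {k : Type*} [Field k] {n : ℕ}

theorem mkₐ_eq_zero_iff (J : TwoSidedIdeal (FreeAlgebra k (Fin n))) (p : FreeAlgebra k (Fin n)) :
    J.ringCon.mkₐ k p = 0 ↔ p ∈ J := by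
  rw [TwoSidedIdeal.mem_iff, ← map_zero (J.ringCon.mkₐ k)]
  exact RingCon.eq _

theorem mkₐ_eq_iff (J : TwoSidedIdeal (FreeAlgebra k (Fin n))) (p q : FreeAlgebra k (Fin n)) :
    J.ringCon.mkₐ k p = J.ringCon.mkₐ k q ↔ p - q ∈ J := by
  rw [← mkₐ_eq_zero_iff, map_sub, sub_eq_zero]

theorem smul_mem_twoSidedIdeal (J : TwoSidedIdeal (FreeAlgebra k (Fin n))) (c : k)
    {p : FreeAlgebra k (Fin n)} (hp : p ∈ J) : c • p ∈ J := by
  rw [Algebra.smul_def]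
  exact J.mul_mem_left _ _ hp

/-- A two-sided ideal of the free algebra as a subspace. -/
def toSubmodule (J : TwoSidedIdeal (FreeAlgebra k (Fin n))) :
    Submodule k (FreeAlgebra k (Fin n)) where
  carrier := J
  add_mem' := J.add_mem
  zero_mem' := J.zero_mem
  smul_mem' c _ hp := smul_mem_twoSidedIdeal J c hp

theorem mem_augIdeal {p : FreeAlgebra k (Fin n)} :
    p ∈ augIdeal k n ↔ FreeAlgebra.lift k (fun _ : Fin n => (0 : k)) p = 0 :=
  TwoSidedIdeal.mem_ker _

theorem mon_of (i : Fin n) : mon k (FreeMonoid.of i) = FreeAlgebra.ι k i :=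
  FreeMonoid.lift_eval_of _ _

theorem span_range_mon :
    Submodule.span k (Set.range (mon k : FreeMonoid (Fin n) →* FreeAlgebra k (Fin n))) = ⊤ := by
  rw [eq_top_iff]
  rintro p -
  induction p using FreeAlgebra.induction with
  | grade0 r =>
    rw [Algebra.algebraMap_eq_smul_one]
    exact Submodule.smul_mem _ _ (Submodule.subset_span ⟨1, map_one _⟩)
  | grade1 i => exact Submodule.subset_span ⟨FreeMonoid.of i, mon_of i⟩
  | mul a b ha hb =>
    have h := Submodule.mul_mem_mul ha hb
    rw [Submodule.span_mul_span] at h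
    refine Submodule.span_mono ?_ h
    rintro _ ⟨_, ⟨u, rfl⟩, _, ⟨w, rfl⟩, rfl⟩
    exact ⟨u * w, map_mul _ _ _⟩
  | add a b ha hb => exact Submodule.add_mem _ ha hb

theorem mon_mem_augIdeal {u : FreeMonoid (Fin n)} (hu : u ≠ 1) : mon k u ∈ augIdeal k n := by
  induction u using FreeMonoid.casesOn with
  | one => exact absurd rfl hu
  | of_mul i w =>
    rw [mem_augIdeal, map_mul, map_mul, mon_of, FreeAlgebra.lift_ι_apply, zero_mul]

theorem one_notMem_augIdeal : (1 : FreeAlgebra k (Fin n)) ∉ augIdeal k n := by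
  rw [mem_augIdeal, map_one]
  exact one_ne_zero

/-- The span of the monomials in an ideal. -/
def monSpan (J : TwoSidedIdeal (FreeAlgebra k (Fin n))) : Submodule k (FreeAlgebra k (Fin n)) :=
  Submodule.span k (mon k '' {u | mon k u ∈ J})

theorem mon_mem_monSpan {J : TwoSidedIdeal (FreeAlgebra k (Fin n))} {u : FreeMonoid (Fin n)}
    (hu : mon k u ∈ J) : mon k u ∈ monSpan J :=
  Submodule.subset_span ⟨u, hu, rfl⟩

theorem monSpan_le (J : TwoSidedIdeal (FreeAlgebra k (Fin n))) : monSpan J ≤ toSubmodule J :=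
  Submodule.span_le.2 (by rintro _ ⟨u, hu, rfl⟩; exact hu)

theorem exists_sub_algebraMap_mem_monSpan (p : FreeAlgebra k (Fin n)) :
    ∃ c : k, p - algebraMap k _ c ∈ monSpan (augIdeal k n) := by
  have hp : p ∈ Submodule.span k (Set.range (mon k : FreeMonoid (Fin n) →* _)) := by
    rw [span_range_mon]; trivial
  induction hp using Submodule.span_induction with
  | mem _ h =>
    obtain ⟨u, rfl⟩ := h
    by_cases hu : u = 1
    · exact ⟨1, by rw [hu, map_one, map_one, sub_self]; exact zero_mem _⟩
    · exact ⟨0, by rw [map_zero, sub_zero]; exact mon_mem_monSpan (mon_mem_augIdeal hu)⟩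
  | zero => exact ⟨0, by simp⟩
  | add a b _ _ ha hb =>
    obtain ⟨c, hc⟩ := ha
    obtain ⟨e, he⟩ := hb
    exact ⟨c + e, by rw [map_add, add_sub_add_comm]; exact add_mem hc he⟩
  | smul r a _ ha =>
    obtain ⟨c, hc⟩ := ha
    refine ⟨r * c, ?_⟩
    have := Submodule.smul_mem _ r hc
    rwa [smul_sub, Algebra.smul_def r (algebraMap k _ c), ← map_mul] at this

theorem mem_monSpan_augIdeal {p : FreeAlgebra k (Fin n)} (hp : p ∈ augIdeal k n) :
    p ∈ monSpan (augIdeal k n) := by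
  obtain ⟨c, hc⟩ := exists_sub_algebraMap_mem_monSpan p
  have h := mem_augIdeal.1 (monSpan_le _ hc)
  rw [map_sub, mem_augIdeal.1 hp, AlgHom.commutes, zero_sub, neg_eq_zero] at h
  have hc0 : c = 0 := h
  rwa [hc0, map_zero, sub_zero] at hc

/-- A subspace which is stable under multiplication by the variables on both sides contains the
two-sided ideal generated by each of its subsets. -/
theorem span_le_of_stable {S : Set (FreeAlgebra k (Fin n))}
    (P : Submodule k (FreeAlgebra k (Fin n))) (hS : S ⊆ P)
    (hl : ∀ i, ∀ p ∈ P, FreeAlgebra.ι k i * p ∈ P) (hr : ∀ i, ∀ p ∈ P, p * FreeAlgebra.ι k i ∈ P)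
    {p : FreeAlgebra k (Fin n)} (hp : p ∈ TwoSidedIdeal.span S) : p ∈ P := by
  have hl' : ∀ q : FreeAlgebra k (Fin n), ∀ p ∈ P, q * p ∈ P := by
    intro q
    induction q using FreeAlgebra.induction with
    | grade0 r => intro p hp; rw [← Algebra.smul_def]; exact P.smul_mem _ hp
    | grade1 i => exact hl i
    | mul a b ha hb => intro p hp; rw [mul_assoc]; exact ha _ (hb _ hp)
    | add a b ha hb => intro p hp; rw [add_mul]; exact add_mem (ha _ hp) (hb _ hp)
  have hr' : ∀ q : FreeAlgebra k (Fin n), ∀ p ∈ P, p * q ∈ P := by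
    intro q
    induction q using FreeAlgebra.induction with
    | grade0 r =>
      intro p hp
      rw [← Algebra.commutes, ← Algebra.smul_def]
      exact P.smul_mem _ hp
    | grade1 i => exact hr i
    | mul a b ha hb => intro p hp; rw [← mul_assoc]; exact hb _ (ha _ hp)
    | add a b ha hb => intro p hp; rw [mul_add]; exact add_mem (ha _ hp) (hb _ hp)
  let I : TwoSidedIdeal (FreeAlgebra k (Fin n)) :=
    TwoSidedIdeal.mk' P P.zero_mem P.add_mem P.neg_mem (hl' _ _) (hr' _ _)
  have hI : TwoSidedIdeal.span S ≤ I :=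
    TwoSidedIdeal.span_le.2 fun q hq => (TwoSidedIdeal.mem_mk' ..).2 (hS hq)
  exact (TwoSidedIdeal.mem_mk' ..).1 (hI hp)

theorem monSpan_ι_mul (J : TwoSidedIdeal (FreeAlgebra k (Fin n))) (i : Fin n)
    {p : FreeAlgebra k (Fin n)} (hp : p ∈ monSpan J) : FreeAlgebra.ι k i * p ∈ monSpan J := by
  induction hp using Submodule.span_induction with
  | mem _ h =>
    obtain ⟨u, hu, rfl⟩ := h
    rw [← mon_of, ← map_mul]
    exact mon_mem_monSpan (by rw [map_mul]; exact J.mul_mem_left _ _ hu)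
  | zero => simp
  | add a b _ _ ha hb => rw [mul_add]; exact add_mem ha hb
  | smul r a _ ha => rw [mul_smul_comm]; exact Submodule.smul_mem _ _ ha

theorem monSpan_mul_ι (J : TwoSidedIdeal (FreeAlgebra k (Fin n))) (i : Fin n)
    {p : FreeAlgebra k (Fin n)} (hp : p ∈ monSpan J) : p * FreeAlgebra.ι k i ∈ monSpan J := by
  induction hp using Submodule.span_induction with
  | mem _ h =>
    obtain ⟨u, hu, rfl⟩ := h
    rw [← mon_of, ← map_mul]
    exact mon_mem_monSpan (by rw [map_mul]; exact J.mul_mem_right _ _ hu)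
  | zero => simp
  | add a b _ _ ha hb => rw [add_mul]; exact add_mem ha hb
  | smul r a _ ha => rw [smul_mul_assoc]; exact Submodule.smul_mem _ _ ha

theorem monSpan_mul_mem {J₁ J₂ J : TwoSidedIdeal (FreeAlgebra k (Fin n))}
    (h : ∀ a ∈ J₁, ∀ b ∈ J₂, a * b ∈ J) {p q : FreeAlgebra k (Fin n)}
    (hp : p ∈ monSpan J₁) (hq : q ∈ monSpan J₂) : p * q ∈ monSpan J := by
  have := Submodule.mul_mem_mul hp hq
  rw [monSpan, monSpan, Submodule.span_mul_span] at this
  refine Submodule.span_mono ?_ this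
  rintro _ ⟨_, ⟨u, hu, rfl⟩, _, ⟨w, hw, rfl⟩, rfl⟩
  refine ⟨u * w, ?_, map_mul _ _ _⟩
  have := h _ hu _ hw
  rwa [← map_mul] at this

/-- A relation modulo the smaller ideal maps to a relation modulo the larger one. -/
theorem linearIndepOn_mono {J J' : TwoSidedIdeal (FreeAlgebra k (Fin n))} (hJ : J' ≤ J)
    {B : Set (FreeMonoid (Fin n))} (h : LinearIndepOn k (fun u => J.ringCon.mkₐ k (mon k u)) B) :
    LinearIndepOn k (fun u => J'.ringCon.mkₐ k (mon k u)) B := by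
  have hle : J'.ringCon ≤ J.ringCon := TwoSidedIdeal.ringCon_le_iff.1 hJ
  exact LinearIndepOn.of_comp (RingCon.factorₐ k hle).toLinearMap h

/-- The quotient by an ideal containing all long words is finite dimensional. -/
theorem finite_quotient {J : TwoSidedIdeal (FreeAlgebra k (Fin n))} {N : ℕ}
    (h : ∀ u : FreeMonoid (Fin n), N < u.length → mon k u ∈ J) :
    Module.Finite k J.ringCon.Quotient := by
  have hfin : {u : FreeMonoid (Fin n) | u.length ≤ N}.Finite := List.finite_length_le (Fin n) N
  refine Module.Finite.of_fg_top ⟨(hfin.image fun u => J.ringCon.mkₐ k (mon k u)).toFinset, ?_⟩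
  rw [Set.Finite.coe_toFinset, eq_top_iff, ← LinearMap.range_eq_top.2
    (show Function.Surjective (J.ringCon.mkₐ k).toLinearMap from RingCon.mkₐ_surjective (α := k) _),
    LinearMap.range_eq_map, ← span_range_mon, Submodule.map_span, Submodule.span_le]
  rintro _ ⟨_, ⟨u, rfl⟩, rfl⟩
  by_cases hu : u.length ≤ N
  · exact Submodule.subset_span ⟨u, hu, rfl⟩
  · have : J.ringCon.mkₐ k (mon k u) = 0 := (mkₐ_eq_zero_iff _ _).2 (h u (not_le.1 hu))
    exact this ▸ zero_mem _

end FreeAlgebraIdeals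

end GMMPAlgebra

/-! ### The inductive step of the construction. -/

namespace GMMPAlgebra

section Admissible

variable {k V W : Type*} [Field k] [AddCommGroup V] [Module k V] [AddCommGroup W] [Module k W]
  {n : ℕ} (L : GMMPAlgebra k V W) {I : Set (W ⧸ LinearMap.range L.d)}
  (y : Module.Basis I k (W ⧸ LinearMap.range L.d))

/-- The ideal `J_{N+1}` in terms of `B̄_N`, `v` and `J_N`. -/
def nextIdeal (B : Finset (FreeMonoid (Fin n))) (v : FreeMonoid (Fin n) → V)
    (J : TwoSidedIdeal (FreeAlgebra k (Fin n))) : TwoSidedIdeal (FreeAlgebra k (Fin n)) :=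
  TwoSidedIdeal.span
    ({p | ∃ a ∈ augIdeal k n, ∃ b ∈ J, p = a * b ∨ p = b * a} ∪ Set.range (L.relationPoly y B v))

variable {L y} {B B' : Finset (FreeMonoid (Fin n))} {v v' : FreeMonoid (Fin n) → V}
  {J : TwoSidedIdeal (FreeAlgebra k (Fin n))}

theorem mul_mem_nextIdeal {a b : FreeAlgebra k (Fin n)} (ha : a ∈ augIdeal k n) (hb : b ∈ J) :
    a * b ∈ nextIdeal L y B v J :=
  TwoSidedIdeal.subset_span (Or.inl ⟨a, ha, b, hb, Or.inl rfl⟩)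

theorem mul_mem_nextIdeal' {a b : FreeAlgebra k (Fin n)} (ha : a ∈ augIdeal k n) (hb : b ∈ J) :
    b * a ∈ nextIdeal L y B v J :=
  TwoSidedIdeal.subset_span (Or.inl ⟨a, ha, b, hb, Or.inr rfl⟩)

theorem relationPoly_mem_nextIdeal (i : I) : L.relationPoly y B v i ∈ nextIdeal L y B v J :=
  TwoSidedIdeal.subset_span (Or.inr ⟨i, rfl⟩)

theorem nextIdeal_le {J' : TwoSidedIdeal (FreeAlgebra k (Fin n))}
    (hl : ∀ a ∈ augIdeal k n, ∀ b ∈ J, a * b ∈ J') (hr : ∀ a ∈ augIdeal k n, ∀ b ∈ J, b * a ∈ J')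
    (hf : ∀ i, L.relationPoly y B v i ∈ J') : nextIdeal L y B v J ≤ J' := by
  refine TwoSidedIdeal.span_le.2 ?_
  rintro _ (⟨a, ha, b, hb, rfl | rfl⟩ | ⟨i, rfl⟩)
  exacts [hl a ha b hb, hr a ha b hb, hf i]

variable (L y B v J) in
/-- The properties of `(B̄_N, v, J_N)` which allow the construction to continue. -/
structure IsAdmissible : Prop where
  le_augIdeal : J ≤ augIdeal k n
  long_mem : ∃ N, ∀ u : FreeMonoid (Fin n), N < u.length → mon k u ∈ J
  next_le : nextIdeal L y B v J ≤ J
  le_monSpan : ∀ p ∈ J, p ∈ monSpan J ⊔ toSubmodule (nextIdeal L y B v J)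
  one_mem : 1 ∈ B
  linearIndepOn : LinearIndepOn k (fun u => J.ringCon.mkₐ k (mon k u))
    (B : Set (FreeMonoid (Fin n)))
  span_eq : Submodule.span k ((fun u => J.ringCon.mkₐ k (mon k u)) '' B) = ⊤

variable (L y B v J B' v') in
/-- `(B̄_{N+1}, v')` is a possible choice at the stage after `(B̄_N, v, J_N)`, apart from the
condition on `d(v_u)`. -/
structure IsExtension : Prop where
  subset : B ⊆ B'
  new_mem : ∀ u ∈ B' \ B, mon k u ∈ J
  agree : ∀ u ∈ B, v' u = v u
  linearIndepOn : LinearIndepOn k (fun u => (nextIdeal L y B v J).ringCon.mkₐ k (mon k u))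
    (B' : Set (FreeMonoid (Fin n)))
  span_eq : Submodule.span k
    ((fun u => (nextIdeal L y B v J).ringCon.mkₐ k (mon k u)) '' B') = ⊤

theorem relationPoly_congr (h : ∀ u ∈ B, v' u = v u) :
    L.relationPoly y B v' = L.relationPoly y B v := by
  funext i
  refine Finset.sum_congr rfl fun s hs => Finset.sum_congr rfl fun t ht => ?_
  rw [h s (Finset.mem_of_mem_erase hs), h t (Finset.mem_of_mem_erase ht)]

/-- Sums over pairs of words change by terms in `𝔪 J + J 𝔪` when the set of words is enlarged by
words in `J`. -/
theorem sum_erase_sub_sum_erase {X : Type*} [AddCommGroup X] (hsub : B ⊆ B')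
    (hnew : ∀ u ∈ B' \ B, mon k u ∈ J) (f : FreeMonoid (Fin n) → FreeMonoid (Fin n) → X)
    (P : AddSubgroup X)
    (hf : ∀ s t, s ≠ 1 → t ≠ 1 → (mon k s ∈ J ∨ mon k t ∈ J) → f s t ∈ P) :
    (∑ s ∈ B'.erase 1, ∑ t ∈ B'.erase 1, f s t) - ∑ s ∈ B.erase 1, ∑ t ∈ B.erase 1, f s t ∈ P := by
  rw [← Finset.sum_product', ← Finset.sum_product', ← Finset.sum_sdiff
    (Finset.product_subset_product (Finset.erase_subset_erase 1 hsub)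
      (Finset.erase_subset_erase 1 hsub)), add_sub_cancel_right]
  refine sum_mem fun p hp => ?_
  simp only [Finset.mem_sdiff, Finset.mem_product, Finset.mem_erase, not_and] at hp
  obtain ⟨⟨⟨hs1, hs⟩, ht1, ht⟩, hn⟩ := hp
  refine hf _ _ hs1 ht1 ?_
  by_cases hsB : p.1 ∈ B
  · exact Or.inr (hnew _ (Finset.mem_sdiff.2 ⟨ht, hn ⟨hs1, hsB⟩ ht1⟩))
  · exact Or.inl (hnew _ (Finset.mem_sdiff.2 ⟨hs, hsB⟩))

theorem mon_mul_mem_nextIdeal {s t : FreeMonoid (Fin n)} (hs : s ≠ 1) (ht : t ≠ 1)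
    (h : mon k s ∈ J ∨ mon k t ∈ J) : mon k (s * t) ∈ nextIdeal L y B v J := by
  rw [map_mul]
  rcases h with h | h
  · exact mul_mem_nextIdeal' (mon_mem_augIdeal ht) h
  · exact mul_mem_nextIdeal (mon_mem_augIdeal hs) h

/-- Besides the old terms, after the agreement of `v'` and `v`, the new relation has only terms `s
t` with a factor in `J`, and these monomials lie in the next ideal. -/
theorem IsExtension.relationPoly_sub_mem (h : IsExtension L y B B' v v' J) (i : I) :
    L.relationPoly y B' v' i - L.relationPoly y B v i ∈ monSpan (nextIdeal L y B v J) := by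
  rw [← relationPoly_congr h.agree]
  refine sum_erase_sub_sum_erase h.subset h.new_mem _ (monSpan _).toAddSubgroup ?_
  intro s t hs ht hst
  exact Submodule.smul_mem _ _ (mon_mem_monSpan (mon_mul_mem_nextIdeal hs ht hst))

theorem exists_long_mem_nextIdeal
    (h : ∃ N, ∀ u : FreeMonoid (Fin n), N < u.length → mon k u ∈ J) :
    ∃ N, ∀ u : FreeMonoid (Fin n), N < u.length → mon k u ∈ nextIdeal L y B v J := by
  obtain ⟨N, hN⟩ := h
  refine ⟨N + 1, fun u hu => ?_⟩
  induction u using FreeMonoid.casesOn with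
  | one => simp at hu
  | of_mul i w =>
    rw [map_mul]
    refine mul_mem_nextIdeal (mon_mem_augIdeal (FreeMonoid.of_ne_one i)) (hN w ?_)
    rw [FreeMonoid.length_mul, FreeMonoid.length_of] at hu
    omega

/-- New and old relations differ by combinations of monomials in the next ideal; this gives
`next_le`, and `le_monSpan` for the generators `fᵢ`. For a generator in `𝔫 J` or `J 𝔫`, split the
factor in `J` by `le_monSpan`: its monomial part stays a combination of monomials, now in the next
ideal, and the rest is pushed one stage further. -/
theorem IsAdmissible.of_isExtension (hJ : IsAdmissible L y B v J)
    (h : IsExtension L y B B' v v' J) : IsAdmissible L y B' v' (nextIdeal L y B v J) where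
  le_augIdeal := hJ.next_le.trans hJ.le_augIdeal
  long_mem := exists_long_mem_nextIdeal hJ.long_mem
  next_le := by
    refine nextIdeal_le (fun a _ b hb => TwoSidedIdeal.mul_mem_left _ _ _ hb)
      (fun a _ b hb => TwoSidedIdeal.mul_mem_right _ _ _ hb) fun i => ?_
    rw [← sub_add_cancel (L.relationPoly y B' v' i) (L.relationPoly y B v i)]
    exact TwoSidedIdeal.add_mem _ (monSpan_le _ (h.relationPoly_sub_mem i))
      (relationPoly_mem_nextIdeal i)
  le_monSpan := by
    intro p hp
    refine span_le_of_stable (monSpan (nextIdeal L y B v J) ⊔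
      toSubmodule (nextIdeal L y B' v' (nextIdeal L y B v J))) ?_ ?_ ?_ hp
    · rintro _ (⟨a, ha, b, hb, h⟩ | ⟨i, rfl⟩)
      · obtain ⟨q, hq, r, hr, rfl⟩ := Submodule.mem_sup.1 (hJ.le_monSpan b hb)
        rcases h with rfl | rfl
        · rw [mul_add]
          exact Submodule.add_mem_sup
            (monSpan_mul_mem (fun _ ha _ hb => mul_mem_nextIdeal ha hb)
              (mem_monSpan_augIdeal ha) hq)
            (mul_mem_nextIdeal ha hr)
        · rw [add_mul]
          exact Submodule.add_mem_sup
            (monSpan_mul_mem (fun _ hb _ ha => mul_mem_nextIdeal' ha hb)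
              hq (mem_monSpan_augIdeal ha))
            (mul_mem_nextIdeal' ha hr)
      · rw [← sub_sub_cancel (L.relationPoly y B' v' i) (L.relationPoly y B v i), sub_eq_add_neg,
          add_comm]
        exact Submodule.add_mem_sup (neg_mem (h.relationPoly_sub_mem i))
          (relationPoly_mem_nextIdeal i)
    · intro i p hp
      obtain ⟨q, hq, r, hr, rfl⟩ := Submodule.mem_sup.1 hp
      rw [mul_add]
      exact Submodule.add_mem_sup (monSpan_ι_mul _ i hq) (TwoSidedIdeal.mul_mem_left _ _ _ hr)
    · intro i p hp
      obtain ⟨q, hq, r, hr, rfl⟩ := Submodule.mem_sup.1 hp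
      rw [add_mul]
      exact Submodule.add_mem_sup (monSpan_mul_ι _ i hq) (TwoSidedIdeal.mul_mem_right _ _ _ hr)
  one_mem := h.subset hJ.one_mem
  linearIndepOn := h.linearIndepOn
  span_eq := h.span_eq

/-- Basis extension: `B` stays independent in the larger quotient, and by `le_monSpan` the words of
`B` and those in `J` together span it. Finiteness holds because long words vanish. -/
theorem IsAdmissible.exists_words (hJ : IsAdmissible L y B v J) :
    ∃ B' : Finset (FreeMonoid (Fin n)), ∀ v', (∀ u ∈ B, v' u = v u) →
      IsExtension L y B B' v v' J := by
  set J' := nextIdeal L y B v J with hJ'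
  have hlin := linearIndepOn_mono hJ.next_le hJ.linearIndepOn
  obtain ⟨S, hS, hBS, hspan, hind⟩ := exists_linearIndepOn_extension hlin
    (Set.subset_union_left (t := {u | mon k u ∈ J}))
  have hfin : Module.Finite k J'.ringCon.Quotient := by
    obtain ⟨N, hN⟩ := exists_long_mem_nextIdeal (L := L) (y := y) (B := B) (v := v) hJ.long_mem
    exact finite_quotient hN
  have hSfin : S.Finite := @Set.toFinite _ S (LinearIndependent.finite hind)
  refine ⟨hSfin.toFinset, fun v' hv' => ⟨?_, ?_, hv', ?_, ?_⟩⟩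
  · intro u hu
    exact hSfin.mem_toFinset.2 (hBS hu)
  · intro u hu
    rw [Finset.mem_sdiff, hSfin.mem_toFinset] at hu
    exact (hS hu.1).resolve_left hu.2
  · rwa [hSfin.coe_toFinset]
  · rw [hSfin.coe_toFinset, eq_top_iff]
    refine le_trans ?_ (Submodule.span_le.2 hspan)
    rintro x -
    obtain ⟨p, rfl⟩ := RingCon.mkₐ_surjective (α := k) J'.ringCon x
    have h1 : J.ringCon.mkₐ k p ∈ Submodule.span k ((fun u => J.ringCon.mkₐ k (mon k u)) '' B) := by
      rw [hJ.span_eq]; trivial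
    rw [show (fun u => J.ringCon.mkₐ k (mon k u)) '' (B : Set (FreeMonoid (Fin n))) =
      (J.ringCon.mkₐ k).toLinearMap '' (mon k '' B) from (Set.image_image ..).symm,
      ← Submodule.map_span] at h1
    obtain ⟨q, hq, hqp⟩ := h1
    have hpq : p - q ∈ J := (mkₐ_eq_iff J p q).1 hqp.symm
    obtain ⟨r, hr, s, hs, hrs⟩ := Submodule.mem_sup.1 (hJ.le_monSpan _ hpq)
    have hp : J'.ringCon.mkₐ k p = J'.ringCon.mkₐ k (q + r) := by
      rw [mkₐ_eq_iff, ← sub_sub, ← hrs, add_sub_cancel_left]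
      exact hs
    rw [hp]
    have hqr : q + r ∈ Submodule.span k (mon k '' ((B : Set (FreeMonoid (Fin n))) ∪
        {u | mon k u ∈ J})) := by
      refine add_mem (Submodule.span_mono ?_ hq) (Submodule.span_mono ?_ hr)
      · exact Set.image_mono Set.subset_union_left
      · exact Set.image_mono Set.subset_union_right
    have := Submodule.mem_map_of_mem (f := (J'.ringCon.mkₐ k).toLinearMap) hqr
    rw [Submodule.map_span, Set.image_image] at this
    exact this

/-- The equation for `d(v_u)` has a solution. -/
theorem exists_d_eq {K : TwoSidedIdeal (FreeAlgebra k (Fin n))}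
    (hK : ∀ i, L.relationPoly y B v i ∈ K) (φ : K.ringCon.Quotient →ₗ[k] k) :
    ∃ w, L.d w = - ∑ s ∈ B.erase 1, ∑ t ∈ B.erase 1,
      φ (K.ringCon.mkₐ k (mon k (s * t))) • L.cup (v s ⊗ₜ[k] v t) := by
  suffices h : (LinearMap.range L.d).mkQ (∑ s ∈ B.erase 1, ∑ t ∈ B.erase 1,
      φ (K.ringCon.mkₐ k (mon k (s * t))) • L.cup (v s ⊗ₜ[k] v t)) = 0 by
    rw [Submodule.mkQ_apply, Submodule.Quotient.mk_eq_zero] at h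
    exact LinearMap.mem_range.1 (neg_mem h)
  -- The `i`-th coordinate of the sum is `φ` applied to the class of the `i`-th relation, which is
  -- zero.
  refine y.ext_elem fun i => ?_
  have h0 : φ (K.ringCon.mkₐ k (L.relationPoly y B v i)) = 0 := by
    rw [(mkₐ_eq_zero_iff _ _).2 (hK i), map_zero]
  rw [map_zero, Finsupp.zero_apply, ← h0, relationPoly]
  simp only [map_sum, map_smul, smul_eq_mul, Finsupp.coe_finsetSum, Finset.sum_apply,
    Finsupp.smul_apply, Submodule.mkQ_apply, Module.Basis.coord_apply]
  exact Finset.sum_congr rfl fun s _ => Finset.sum_congr rfl fun t _ => mul_comm _ _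

end Admissible

end GMMPAlgebra

/-! ### Existence of all the choices. -/

namespace GMMPAlgebra

section Existence

variable {k V W : Type*} [Field k] [AddCommGroup V] [Module k V] [AddCommGroup W] [Module k W]
  {n : ℕ} {L : GMMPAlgebra k V W} {I : Set (W ⧸ LinearMap.range L.d)}
  {y : Module.Basis I k (W ⧸ LinearMap.range L.d)}

theorem relationPoly_singleton_one (v : FreeMonoid (Fin n) → V) (i : I) :
    L.relationPoly y {1} v i = 0 := by
  simp [relationPoly]

theorem isAdmissible_zero (v : FreeMonoid (Fin n) → V) :
    IsAdmissible L y {1} v (augIdeal k n) where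
  le_augIdeal := le_rfl
  long_mem := ⟨0, fun u hu => mon_mem_augIdeal (by rintro rfl; simp at hu)⟩
  next_le := nextIdeal_le (fun a _ b hb => TwoSidedIdeal.mul_mem_left _ _ _ hb)
    (fun a _ b hb => TwoSidedIdeal.mul_mem_right _ _ _ hb)
    (fun i => by rw [relationPoly_singleton_one]; exact TwoSidedIdeal.zero_mem _)
  le_monSpan p hp := Submodule.mem_sup_left (mem_monSpan_augIdeal hp)
  one_mem := Finset.mem_singleton_self 1
  linearIndepOn := by
    rw [Finset.coe_singleton]
    refine LinearIndepOn.singleton ?_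
    rw [Ne, mkₐ_eq_zero_iff, map_one]
    exact one_notMem_augIdeal
  span_eq := by
    rw [eq_top_iff]
    rintro x -
    obtain ⟨p, rfl⟩ := RingCon.mkₐ_surjective (α := k) (augIdeal k n).ringCon x
    obtain ⟨c, hc⟩ := exists_sub_algebraMap_mem_monSpan p
    rw [Finset.coe_singleton, Set.image_singleton, (mkₐ_eq_iff _ _ _).2 (monSpan_le _ hc),
      Algebra.algebraMap_eq_smul_one, map_smul, map_one]
    exact Submodule.smul_mem _ _ (Submodule.mem_span_singleton_self _)

/-- The words of length at most one. -/
def shortWords (n : ℕ) : Finset (FreeMonoid (Fin n)) :=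
  insert 1 (Finset.univ.image FreeMonoid.of)

theorem mem_shortWords {u : FreeMonoid (Fin n)} :
    u ∈ shortWords n ↔ u = 1 ∨ ∃ i, FreeMonoid.of i = u := by
  simp [shortWords]

/-- The homomorphism `k⟨x₁, …, xₙ⟩ → k[ε]` with `xᵢ ↦ ε` and `xⱼ ↦ 0` for `j ≠ i`. -/
def linearPart (i : Fin n) : FreeAlgebra k (Fin n) →ₐ[k] DualNumber k :=
  FreeAlgebra.lift k (Pi.single i DualNumber.eps)

theorem linearPart_fst (i : Fin n) (p : FreeAlgebra k (Fin n)) :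
    (linearPart i p).fst = FreeAlgebra.lift k (fun _ : Fin n => (0 : k)) p := by
  change (TrivSqZeroExt.fstHom k k k).comp (linearPart i) p = _
  congr 1
  ext j
  by_cases h : j = i <;> simp [linearPart, h]

/-- Stage `0` has no relations, so only products of two elements of `𝔫` occur, and `ε² = 0` in the
dual numbers. This is used to show that the variables are independent in `H̄_1`. -/
theorem linearPart_nextIdeal (v : FreeMonoid (Fin n) → V) (i : Fin n)
    {p : FreeAlgebra k (Fin n)} (hp : p ∈ nextIdeal L y {1} v (augIdeal k n)) :
    linearPart i p = 0 := by
  have key : ∀ a ∈ augIdeal k n, ∀ b ∈ augIdeal k n, linearPart i (a * b) = 0 := by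
    intro a ha b hb
    rw [mem_augIdeal, ← linearPart_fst i] at ha hb
    rw [map_mul]
    ext <;> simp [ha, hb]
  rw [← TwoSidedIdeal.mem_ker]
  refine (nextIdeal_le ?_ ?_ ?_ : nextIdeal L y {1} v (augIdeal k n) ≤ _) hp
  · exact fun a ha b hb => (TwoSidedIdeal.mem_ker _).2 (key a ha b hb)
  · exact fun a ha b hb => (TwoSidedIdeal.mem_ker _).2 (key b hb a ha)
  · intro j
    rw [relationPoly_singleton_one]
    exact TwoSidedIdeal.zero_mem _

theorem isExtension_one {v v' : FreeMonoid (Fin n) → V} (hv : v' 1 = v 1) :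
    IsExtension L y {1} (shortWords n) v v' (augIdeal k n) where
  subset := by simp [shortWords]
  new_mem u hu := mon_mem_augIdeal (by
    rw [Finset.mem_sdiff, Finset.mem_singleton] at hu
    exact hu.2)
  agree u hu := by rw [Finset.mem_singleton.1 hu, hv]
  linearIndepOn := by
    rw [linearIndepOn_finset_iff]
    intro c hc
    have hmem : ∑ u ∈ shortWords n, c u • mon k u ∈ nextIdeal L y {1} v (augIdeal k n) := by
      rw [← mkₐ_eq_zero_iff, map_sum]
      simpa only [map_smul] using hc
    have hsum : ∀ X : FreeMonoid (Fin n) → FreeAlgebra k (Fin n), ∑ u ∈ shortWords n, X u =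
        X 1 + ∑ i, X (FreeMonoid.of i) := by
      intro X
      rw [shortWords, Finset.sum_insert (by simp [FreeMonoid.of_ne_one]),
        Finset.sum_image FreeMonoid.of_injective.injOn]
    rw [hsum] at hmem
    have h1 : ∀ i, (linearPart i (c 1 • mon k 1 +
        ∑ j, c (FreeMonoid.of j) • mon k (FreeMonoid.of j))).snd = c (FreeMonoid.of i) := by
      intro i
      rw [map_add, map_sum]
      simp only [map_smul, map_one, mon_of, linearPart, FreeAlgebra.lift_ι_apply]
      rw [TrivSqZeroExt.snd_add, TrivSqZeroExt.snd_sum, Finset.sum_eq_single i]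
      · simp
      · intro j _ hj
        simp [hj]
      · simp
    have h2 : FreeAlgebra.lift k (fun _ : Fin n => (0 : k)) (c 1 • mon k 1 +
        ∑ j, c (FreeMonoid.of j) • mon k (FreeMonoid.of j)) = c 1 := by
      simp [mon_of]
    intro u hu
    rcases mem_shortWords.1 hu with rfl | ⟨i, rfl⟩
    · rw [← h2, ← mem_augIdeal]
      exact (isAdmissible_zero v).next_le hmem
    · rw [← h1 i, linearPart_nextIdeal v i hmem, TrivSqZeroExt.snd_zero]
  span_eq := by
    rw [eq_top_iff, ← LinearMap.range_eq_top.2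
      (show Function.Surjective ((nextIdeal L y {1} v (augIdeal k n)).ringCon.mkₐ k).toLinearMap
        from RingCon.mkₐ_surjective (α := k) _),
      LinearMap.range_eq_map, ← span_range_mon, Submodule.map_span, Submodule.span_le]
    rintro _ ⟨_, ⟨u, rfl⟩, rfl⟩
    by_cases hu : u ∈ shortWords n
    · exact Submodule.subset_span ⟨u, hu, rfl⟩
    · have : (nextIdeal L y {1} v (augIdeal k n)).ringCon.mkₐ k (mon k u) = 0 := by
        rw [mkₐ_eq_zero_iff]
        induction u using FreeMonoid.casesOn with
        | one => exact absurd (mem_shortWords.2 (Or.inl rfl)) hu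
        | of_mul i w =>
          rw [map_mul]
          refine mul_mem_nextIdeal (mon_mem_augIdeal (FreeMonoid.of_ne_one i))
            (mon_mem_augIdeal ?_)
          rintro rfl
          exact hu (mem_shortWords.2 (Or.inr ⟨i, (mul_one _).symm⟩))
      exact this ▸ zero_mem _

/-- The basis of the quotient given by `B`. -/
def IsAdmissible.basis {B : Finset (FreeMonoid (Fin n))} {v : FreeMonoid (Fin n) → V}
    {J : TwoSidedIdeal (FreeAlgebra k (Fin n))} (h : IsAdmissible L y B v J) :
    Module.Basis B k J.ringCon.Quotient :=
  Module.Basis.mk (v := fun u : B => J.ringCon.mkₐ k (mon k u.1)) h.linearIndepOn (by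
    rw [← h.span_eq]
    refine Submodule.span_mono ?_
    rintro _ ⟨u, hu, rfl⟩
    exact ⟨⟨u, hu⟩, rfl⟩)

theorem IsAdmissible.basis_apply {B : Finset (FreeMonoid (Fin n))} {v : FreeMonoid (Fin n) → V}
    {J : TwoSidedIdeal (FreeAlgebra k (Fin n))} (h : IsAdmissible L y B v J) (u : B) :
    h.basis u = J.ringCon.mkₐ k (mon k u.1) :=
  Module.Basis.mk_apply ..

variable (L y n) in
/-- The data of a stage of the construction. -/
structure Stage where
  B : Finset (FreeMonoid (Fin n))
  v : FreeMonoid (Fin n) → V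
  J : TwoSidedIdeal (FreeAlgebra k (Fin n))
  admissible : IsAdmissible L y B v J

/-- `s'` is a possible choice at the stage after `s`. -/
structure Stage.IsNext (s s' : Stage n L y) : Prop where
  J_eq : s'.J = nextIdeal L y s.B s.v s.J
  subset : s.B ⊆ s'.B
  new_mem : ∀ u ∈ s'.B \ s.B, mon k u ∈ s.J
  agree : ∀ u ∈ s.B, s'.v u = s.v u
  d_v : ∀ u : s'.B, u.1 ∉ s.B → L.d (s'.v u.1) = - ∑ t₁ ∈ s.B.erase 1, ∑ t₂ ∈ s.B.erase 1,
    s'.admissible.basis.repr (s'.J.ringCon.mkₐ k (mon k (t₁ * t₂))) u •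
      L.cup (s.v t₁ ⊗ₜ[k] s.v t₂)

theorem Stage.exists_isNext (s : Stage n L y) : ∃ s', Stage.IsNext s s' := by
  obtain ⟨B', hB'⟩ := s.admissible.exists_words
  have hadm := s.admissible.of_isExtension (hB' s.v fun _ _ => rfl)
  choose w hw using fun u : B' => exists_d_eq (v := s.v) (B := s.B) (L := L) (y := y)
    (fun i => relationPoly_mem_nextIdeal (J := s.J) i) (hadm.basis.coord u)
  classical
  let v' : FreeMonoid (Fin n) → V := fun u =>
    if u ∈ s.B then s.v u else if hu : u ∈ B' then w ⟨u, hu⟩ else 0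
  have hv' : ∀ u ∈ s.B, v' u = s.v u := fun u hu => if_pos hu
  have hext := hB' v' hv'
  refine ⟨⟨B', v', _, s.admissible.of_isExtension hext⟩, rfl, hext.subset, hext.new_mem, hv', ?_⟩
  intro u hu
  have : v' u.1 = w u := by simp only [v', if_neg hu, u.2, dif_pos]
  exact (congrArg L.d this).trans (hw u)

/-- The construction can be carried out. -/
theorem nonempty_masseyData (L : GMMPAlgebra k V W) (x : Fin n → V) :
    Nonempty (MasseyData L x) := by
  let y := Module.Basis.ofVectorSpace k (W ⧸ LinearMap.range L.d)
  classical
  let v₀ : FreeMonoid (Fin n) → V := fun u => if h : ∃ i, FreeMonoid.of i = u then x h.choose else 0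
  have hv₀ : ∀ i, v₀ (FreeMonoid.of i) = x i := by
    intro i
    have h : ∃ j, FreeMonoid.of j = FreeMonoid.of i := ⟨i, rfl⟩
    simp only [v₀, dif_pos h, FreeMonoid.of_injective h.choose_spec]
  let s₀ : Stage n L y := ⟨_, v₀, _, isAdmissible_zero v₀⟩
  let s₁ : Stage n L y := ⟨_, v₀, _, (isAdmissible_zero v₀).of_isExtension
    (isExtension_one (v := v₀) (v' := v₀) rfl)⟩
  choose nxt hnxt using fun s : Stage n L y => s.exists_isNext
  -- Stages `0` and `1` are prescribed, since `v` on the variables is given by `x` and not by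
  -- solving an equation; the iteration starts at stage `1`.
  let S : ℕ → Stage n L y := fun N => N.casesOn s₀ fun M => nxt^[M] s₁
  have hS : ∀ N, 1 ≤ N → Stage.IsNext (S N) (S (N + 1)) := by
    rintro (_ | N) hN
    · omega
    · change Stage.IsNext (nxt^[N] s₁) (nxt^[N + 1] s₁)
      rw [Function.iterate_succ_apply']
      exact hnxt _
  have hsub : ∀ N, (S N).B ⊆ (S (N + 1)).B := by
    rintro (_ | N)
    · exact (isExtension_one (L := L) (y := y) (v := v₀) (v' := v₀) rfl).subset
    · exact (hS (N + 1) (by omega)).subset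
  have hnew : ∀ N, ∀ u ∈ (S (N + 1)).B \ (S N).B, mon k u ∈ (S N).J := by
    rintro (_ | N)
    · exact (isExtension_one (L := L) (y := y) (v := v₀) (v' := v₀) rfl).new_mem
    · exact (hS (N + 1) (by omega)).new_mem
  have hagree : ∀ N, ∀ u ∈ (S N).B, (S (N + 1)).v u = (S N).v u := by
    rintro (_ | N)
    · exact fun _ _ => rfl
    · exact (hS (N + 1) (by omega)).agree
  have hJ : ∀ N, (S (N + 1)).J = nextIdeal L y (S N).B (S N).v (S N).J := by
    rintro (_ | N)
    · rfl
    · exact (hS (N + 1) (by omega)).J_eq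
  have hmono : Monotone fun N => (S N).B := monotone_nat_of_le_succ hsub
  have hagree' : ∀ {M N}, M ≤ N → ∀ u ∈ (S M).B, (S N).v u = (S M).v u := by
    intro M N hMN u hu
    induction N, hMN using Nat.le_induction with
    | base => rfl
    | succ N hMN ih => rw [hagree N u (hmono hMN hu), ih]
  -- A word takes its value from the first stage containing it; all later stages agree.
  let v : FreeMonoid (Fin n) → V := fun u =>
    if h : ∃ N, u ∈ (S N).B then (S (Nat.find h)).v u else 0
  have hv : ∀ N, ∀ u ∈ (S N).B, v u = (S N).v u := by
    intro N u hu
    have h : ∃ N, u ∈ (S N).B := ⟨N, hu⟩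
    simp only [v, dif_pos h]
    exact (hagree' (Nat.find_min' h hu) u (Nat.find_spec h)).symm
  have hstage : ∀ N, L.stageIdeal y (fun N => (S N).B) v N = (S N).J := by
    intro N
    induction N with
    | zero => rfl
    | succ N ih =>
      rw [hJ, nextIdeal, ← relationPoly_congr (hv N), ← ih]
      rfl
  -- Basis and coordinates are kept in one statement, so that the equality of ideals `hstage` can be
  -- rewritten in the dependent types at once.
  have hbasis : ∀ N, ∃ b : Module.Basis (S N).B k
      (L.stageIdeal y (fun N => (S N).B) v N).ringCon.Quotient,
      (∀ u, b u = (L.stageIdeal y (fun N => (S N).B) v N).ringCon.mkₐ k (mon k u.1)) ∧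
      ∀ p u, b.repr ((L.stageIdeal y (fun N => (S N).B) v N).ringCon.mkₐ k p) u =
        (S N).admissible.basis.repr ((S N).J.ringCon.mkₐ k p) u := by
    intro N
    rw [hstage N]
    exact ⟨(S N).admissible.basis, fun u => IsAdmissible.basis_apply _ u, fun _ _ => rfl⟩
  choose b hb hrepr using hbasis
  refine ⟨⟨_, y, fun N => (S N).B, v, rfl, rfl, hsub, ?_, b, hb, ?_, ?_⟩⟩
  · intro N u hu
    rw [hstage]
    exact hnew N u hu
  · intro i
    rw [hv 1 _ (mem_shortWords.2 (Or.inr ⟨i, rfl⟩))]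
    exact hv₀ i
  · intro N hN u hu
    rw [hv (N + 1) u.1 u.2, (hS N hN).d_v u hu]
    congr 1
    refine Finset.sum_congr rfl fun s hs => Finset.sum_congr rfl fun t ht => ?_
    rw [hrepr, hv N s (Finset.mem_of_mem_erase hs), hv N t (Finset.mem_of_mem_erase ht)]

end Existence

end GMMPAlgebra

/-! ### Compatibility of the stages for given choices. -/

namespace GMMPAlgebra

namespace MasseyData

section Stages

variable {k V W : Type*} [Field k] [AddCommGroup V] [Module k V] [AddCommGroup W] [Module k W]
  {n : ℕ} {L : GMMPAlgebra k V W} {x : Fin n → V} (R : MasseyData L x)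

/-- The ideal `J_N`. -/
abbrev ideal (N : ℕ) : TwoSidedIdeal (FreeAlgebra k (Fin n)) := L.stageIdeal R.y R.B R.v N

theorem toStage_eq_zero_iff (N : ℕ) (p : FreeAlgebra k (Fin n)) :
    R.toStage N p = 0 ↔ p ∈ R.ideal N :=
  mkₐ_eq_zero_iff _ _

theorem toStage_surjective (N : ℕ) : Function.Surjective (R.toStage N) :=
  RingCon.mkₐ_surjective (α := k) _

theorem isExtension (N : ℕ) :
    IsExtension L R.y (R.B N) (R.B (N + 1)) R.v R.v (R.ideal N) where
  subset := R.B_mono N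
  new_mem := R.B_new N
  agree _ _ := rfl
  linearIndepOn := by
    have h := (R.basis (N + 1)).linearIndependent
    simp only [funext (R.basis_apply (N + 1))] at h
    exact h
  span_eq := by
    have h := (R.basis (N + 1)).span_eq
    rw [funext (R.basis_apply (N + 1))] at h
    refine Eq.trans (congrArg _ ?_) h
    ext z
    constructor
    · rintro ⟨u, hu, rfl⟩
      exact ⟨⟨u, hu⟩, rfl⟩
    · rintro ⟨u, rfl⟩
      exact ⟨u.1, u.2, rfl⟩

theorem isAdmissible (N : ℕ) : IsAdmissible L R.y (R.B N) R.v (R.ideal N) := by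
  induction N with
  | zero =>
    rw [R.B_zero]
    exact isAdmissible_zero R.v
  | succ N ih => exact ih.of_isExtension (R.isExtension N)

theorem ideal_succ_le (N : ℕ) : R.ideal (N + 1) ≤ R.ideal N :=
  (R.isAdmissible N).next_le

theorem mul_mem_ideal {N : ℕ} {p q : FreeAlgebra k (Fin n)} (hp : p ∈ augIdeal k n)
    (hq : q ∈ R.ideal N) : p * q ∈ R.ideal (N + 1) :=
  mul_mem_nextIdeal hp hq

theorem mul_mem_ideal' {N : ℕ} {p q : FreeAlgebra k (Fin n)} (hp : p ∈ augIdeal k n)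
    (hq : q ∈ R.ideal N) : q * p ∈ R.ideal (N + 1) :=
  mul_mem_nextIdeal' hp hq

theorem pow_mem_ideal {p : FreeAlgebra k (Fin n)} (hp : p ∈ augIdeal k n) (N : ℕ) :
    p ^ (N + 1) ∈ R.ideal N := by
  induction N with
  | zero => rw [zero_add, pow_one]; exact hp
  | succ N ih => rw [pow_succ']; exact R.mul_mem_ideal hp ih

/-- The transition map to `H̄_N` fixes old basis monomials and kills the new ones, so the coordinate
at an old word factors through it. -/
theorem repr_succ (N : ℕ) (p : FreeAlgebra k (Fin n)) (u : FreeMonoid (Fin n)) (hu : u ∈ R.B N)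
    (hu' : u ∈ R.B (N + 1)) :
    (R.basis (N + 1)).repr (R.toStage (N + 1) p) ⟨u, hu'⟩ =
      (R.basis N).repr (R.toStage N p) ⟨u, hu⟩ := by
  have hle : (R.ideal (N + 1)).ringCon ≤ (R.ideal N).ringCon :=
    TwoSidedIdeal.ringCon_le_iff.1 (R.ideal_succ_le N)
  have h : (R.basis (N + 1)).coord ⟨u, hu'⟩ =
      (R.basis N).coord ⟨u, hu⟩ ∘ₗ (RingCon.factorₐ k hle).toLinearMap := by
    refine (R.basis (N + 1)).ext fun w => ?_
    have hw : (RingCon.factorₐ k hle).toLinearMap (R.basis (N + 1) w) =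
        R.toStage N (mon k w.1) := by
      rw [R.basis_apply]
      rfl
    rw [LinearMap.comp_apply, hw, Module.Basis.coord_apply, Module.Basis.coord_apply,
      Module.Basis.repr_self]
    by_cases hwN : w.1 ∈ R.B N
    · rw [show R.toStage N (mon k w.1) = R.basis N ⟨w.1, hwN⟩ from (R.basis_apply N ⟨_, hwN⟩).symm,
        Module.Basis.repr_self, Finsupp.single_apply, Finsupp.single_apply]
      simp only [Subtype.ext_iff]
    · rw [(R.toStage_eq_zero_iff N _).2 (R.B_new N _ (Finset.mem_sdiff.2 ⟨w.2, hwN⟩)), map_zero,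
        Finsupp.single_apply, if_neg, Finsupp.zero_apply]
      rintro rfl
      exact hwN hu
  exact LinearMap.congr_fun h (R.toStage (N + 1) p)

/-- The equation for `d(v_u)` holds for all `1 ≠ u ∈ B̄_N`, with the sum over `B̄_N`. -/
theorem d_v_eq (hx : ∀ i, L.d (x i) = 0) (N : ℕ) (u : R.B N) (hu : u.1 ≠ 1) :
    L.d (R.v u.1) = - ∑ s ∈ (R.B N).erase 1, ∑ t ∈ (R.B N).erase 1,
      (R.basis N).repr (R.toStage N (mon k (s * t))) u • L.cup (R.v s ⊗ₜ[k] R.v t) := by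
  induction N with
  | zero =>
    have := u.2
    simp only [R.B_zero, Finset.mem_singleton] at this
    exact absurd this hu
  | succ N ih =>
    have hsum := sum_erase_sub_sum_erase (R.B_mono N) (R.B_new N)
      (fun s t => (R.basis (N + 1)).repr (R.toStage (N + 1) (mon k (s * t))) u •
        L.cup (R.v s ⊗ₜ[k] R.v t)) ⊥ (by
      intro s t hs ht hst
      have h : R.toStage (N + 1) (mon k (s * t)) = 0 :=
        (R.toStage_eq_zero_iff _ _).2 (mon_mul_mem_nextIdeal hs ht hst)
      rw [h, map_zero, Finsupp.zero_apply, zero_smul]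
      exact zero_mem _)
    rw [AddSubgroup.mem_bot, sub_eq_zero] at hsum
    rw [hsum]
    by_cases huN : u.1 ∈ R.B N
    · rw [ih ⟨u.1, huN⟩ hu]
      congr 1
      refine Finset.sum_congr rfl fun s _ => Finset.sum_congr rfl fun t _ => ?_
      rw [← R.repr_succ N _ u.1 huN u.2]
    -- For `N = 0` the word is a variable: `x i` is a cocycle and the sum over `{1}.erase 1` is
    -- empty.
    · rcases Nat.eq_zero_or_pos N with rfl | hN
      · have h1 : u.1 ∈ shortWords n :=
          Eq.mp (congrArg (fun S => u.1 ∈ S) R.B_one) u.2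
        obtain ⟨i, hi⟩ := (mem_shortWords.1 h1).resolve_left hu
        rw [← hi, R.v_of, hx, R.B_zero]
        simp
      · exact R.d_v N hN u huN

end Stages

end MasseyData

end GMMPAlgebra

/-! ### Cochains with values in `End_k(A/𝔪) ≅ k`. -/

namespace Hochschild

section OneDimensional

variable {k A : Type*} [Field k] [CommRing A] [Algebra k A] {m : Ideal A}
  (hk : Function.Bijective (algebraMap k (A ⧸ m)))

/-- The isomorphism `A/𝔪 ≃ k`. -/
def residue : (A ⧸ m) ≃ₐ[k] k :=
  (AlgEquiv.ofBijective (Algebra.ofId k (A ⧸ m)) hk).symm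

/-- The augmentation `A → A/𝔪 ≃ k`. -/
def aug : A →ₐ[k] k :=
  (residue hk).toAlgHom.comp (Ideal.Quotient.mkₐ k m)

theorem aug_eq_zero_iff {a : A} : aug hk a = 0 ↔ a ∈ m := by
  rw [← Ideal.Quotient.eq_zero_iff_mem]
  exact (residue hk).map_eq_zero_iff

theorem sub_aug_mem (a : A) : a - algebraMap k A (aug hk a) ∈ m := by
  rw [← aug_eq_zero_iff hk, map_sub, AlgHom.commutes]
  exact sub_self _

include hk in
theorem eq_smul_one (f : Module.End k (A ⧸ m)) : f = residue hk (f 1) • 1 := by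
  have h1 : ∀ z : A ⧸ m, z = residue hk z • (1 : A ⧸ m) := by
    intro z
    apply (residue hk).injective
    rw [map_smul, map_one, smul_eq_mul, mul_one]
  refine LinearMap.ext fun z => ?_
  rw [h1 z, map_smul, LinearMap.smul_apply, Module.End.one_apply, smul_comm, ← h1 (f 1)]

/-- The isomorphism `End_k(A/𝔪) ≃ k`. -/
def scalar : Module.End k (A ⧸ m) →ₐ[k] k :=
  AlgHom.ofLinearMap ((residue hk).toLinearMap ∘ₗ LinearMap.applyₗ (1 : A ⧸ m))
    (by simp) (by
      intro f g
      rw [eq_smul_one hk f, eq_smul_one hk g]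
      simp [mul_comm])

theorem scalar_smul_one (c : k) : scalar hk (c • 1) = c := by
  rw [map_smul, map_one, smul_eq_mul, mul_one]

theorem scalar_injective : Function.Injective (scalar hk) := by
  intro f g h
  rw [eq_smul_one hk f, eq_smul_one hk g]
  exact congrArg (· • (1 : Module.End k (A ⧸ m))) h

theorem scalar_rho (a : A) : scalar hk (rho k A (A ⧸ m) a) = aug hk a := by
  change residue hk (MulOpposite.op a • (1 : A ⧸ m)) = residue hk (Ideal.Quotient.mk m a)
  congr 1
  change Ideal.Quotient.mk m (1 * a) = _
  rw [one_mul]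

theorem scalar_d1 (φ : C1 k A (A ⧸ m)) (a b : A) :
    scalar hk (d1 k A (A ⧸ m) φ (a ⊗ₜ b)) =
      scalar hk (φ b) * aug hk a - scalar hk (φ (a * b)) + aug hk b * scalar hk (φ a) := by
  rw [d1_tmul, map_add, map_sub, map_mul (scalar hk), map_mul (scalar hk), scalar_rho, scalar_rho]

theorem C2_ext {f g : C2 k A (A ⧸ m)}
    (h : ∀ a b, scalar hk (f (a ⊗ₜ b)) = scalar hk (g (a ⊗ₜ b))) : f = g :=
  TensorProduct.ext' fun a b => scalar_injective hk (h a b)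

-- `End_k(A/𝔪)` is commutative, so commutators vanish.
include hk in
theorem d0_eq_zero : d0 k A (A ⧸ m) = 0 := by
  refine LinearMap.ext fun θ => LinearMap.ext fun a => scalar_injective hk ?_
  change scalar hk (rho k A _ a * θ - θ * rho k A _ a) = scalar hk 0
  rw [map_sub, map_mul, map_mul, mul_comm, sub_self, map_zero]

/-- The cochain with values in `End_k(A/𝔪)` given by a `k`-valued one. -/
def ofFunctional (l : A →ₗ[k] k) : C1 k A (A ⧸ m) :=
  l.smulRight 1

theorem scalar_ofFunctional (l : A →ₗ[k] k) (a : A) :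
    scalar hk (ofFunctional (m := m) l a) = l a :=
  scalar_smul_one hk _

/-- The functional `a ↦ l(a) - l(1) ε(a)`. -/
def reduced (l : A →ₗ[k] k) : A →ₗ[k] k :=
  l - l 1 • (aug hk).toLinearMap

theorem reduced_apply (l : A →ₗ[k] k) (a : A) :
    reduced hk l a = l (a - algebraMap k A (aug hk a)) := by
  rw [map_sub, Algebra.algebraMap_eq_smul_one, map_smul]
  simp [reduced, mul_comm]

/-- As `(dε)(a ⊗ b) = ε(a) ε(b)`, subtracting `l(1) ε` leaves a coboundary that sees `l` only on
products of two elements of `𝔪`. This turns functionals into cochains with controlled coboundary. -/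
theorem scalar_d1_reduced (l : A →ₗ[k] k) (a b : A) :
    scalar hk (d1 k A (A ⧸ m) (ofFunctional (reduced hk l)) (a ⊗ₜ b)) =
      - l ((a - algebraMap k A (aug hk a)) * (b - algebraMap k A (aug hk b))) := by
  have h : (a - algebraMap k A (aug hk a)) * (b - algebraMap k A (aug hk b)) =
      a * b - aug hk a • b - aug hk b • a + (aug hk a * aug hk b) • 1 := by
    simp only [Algebra.algebraMap_eq_smul_one, mul_sub, sub_mul, smul_mul_assoc, mul_smul_comm,
      one_mul, mul_one, smul_sub, mul_smul]
    rw [smul_comm (aug hk b) (aug hk a)]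
    abel
  rw [scalar_d1, scalar_ofFunctional, scalar_ofFunctional, scalar_ofFunctional, h]
  simp only [reduced, map_add, map_sub, map_smul, LinearMap.sub_apply, LinearMap.smul_apply,
    AlgHom.toLinearMap_apply, map_mul, smul_eq_mul]
  ring

end OneDimensional

end Hochschild

/-! ### The homomorphisms `φ_N : A → H̄_N`. -/

namespace Hochschild

open GMMPAlgebra

/-- The comparison of coefficients behind multiplicativity, with `T` the nontrivial basis monomials
and `β` their structure constants. -/
theorem smul_one_add_sum_mul {k H ι : Type*} [Field k] [Ring H] [Algebra k H] (S : Finset ι)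
    (T : ι → H) (β : ι → ι → ι → k)
    (hT : ∀ s ∈ S, ∀ t ∈ S, T s * T t = ∑ u ∈ S, β s t u • T u) (c e : k) (f g h : ι → k)
    (hh : ∀ u ∈ S, h u = c * g u + e * f u + ∑ s ∈ S, ∑ t ∈ S, β s t u * (f s * g t)) :
    (c * e) • (1 : H) + ∑ u ∈ S, h u • T u =
      (c • (1 : H) + ∑ u ∈ S, f u • T u) * (e • (1 : H) + ∑ u ∈ S, g u • T u) := by
  have hsq : (∑ s ∈ S, f s • T s) * (∑ t ∈ S, g t • T t) =
      ∑ u ∈ S, (∑ s ∈ S, ∑ t ∈ S, β s t u * (f s * g t)) • T u := by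
    simp only [Finset.sum_mul_sum, Finset.sum_smul]
    rw [Finset.sum_comm (s := S) (t := S) (f := fun u s => ∑ t ∈ S, (β s t u * (f s * g t)) • T u)]
    refine Finset.sum_congr rfl fun s hs => ?_
    rw [Finset.sum_comm]
    refine Finset.sum_congr rfl fun t ht => ?_
    rw [smul_mul_smul_comm, hT s hs t ht, Finset.smul_sum]
    exact Finset.sum_congr rfl fun u _ => by rw [smul_smul, mul_comm]
  have hu : ∀ u ∈ S, h u • T u = c • g u • T u + e • f u • T u +
      (∑ s ∈ S, ∑ t ∈ S, β s t u * (f s * g t)) • T u := by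
    intro u hu
    rw [hh u hu, add_smul, add_smul, mul_smul, mul_smul]
  rw [Finset.sum_congr rfl hu, Finset.sum_add_distrib, Finset.sum_add_distrib, ← hsq,
    ← Finset.smul_sum, ← Finset.smul_sum]
  simp only [add_mul, mul_add, smul_mul_assoc, mul_smul_comm, one_mul, mul_one, mul_smul,
    smul_add]
  rw [smul_comm e c]
  abel

section Representation

variable {k A : Type*} [Field k] [CommRing A] [Algebra k A] {m : Ideal A}
  (hk : Function.Bijective (algebraMap k (A ⧸ m))) {n : ℕ} {x : Fin n → C1 k A (A ⧸ m)}
  (R : MasseyData (gmmp k A (A ⧸ m)) x)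

/-- The functional `A → k` corresponding to `v_u`. -/
def coef (u : FreeMonoid (Fin n)) : A →ₗ[k] k :=
  (scalar hk).toLinearMap ∘ₗ R.v u

/-- The element `ε(a) + ∑ v_t(a) t` of the free algebra, where `1 ≠ t ∈ B̄_N`. -/
def versalPoly (N : ℕ) : A →ₗ[k] FreeAlgebra k (Fin n) :=
  (aug hk).toLinearMap.smulRight 1 +
    ∑ t ∈ (R.B N).erase 1, (coef hk R t).smulRight (mon k t)

theorem versalPoly_apply (N : ℕ) (a : A) : versalPoly hk R N a =
    algebraMap k _ (aug hk a) + ∑ t ∈ (R.B N).erase 1, coef hk R t a • mon k t := by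
  rw [Algebra.algebraMap_eq_smul_one]
  simp [versalPoly]

theorem versalPoly_sub_mem (N : ℕ) (a : A) :
    versalPoly hk R N a - algebraMap k _ (aug hk a) ∈ augIdeal k n := by
  rw [versalPoly_apply, add_sub_cancel_left]
  exact sum_mem fun t ht =>
    smul_mem_twoSidedIdeal _ _ (mon_mem_augIdeal (Finset.ne_of_mem_erase ht))

theorem lift_versalPoly (N : ℕ) (a : A) :
    FreeAlgebra.lift k (fun _ : Fin n => (0 : k)) (versalPoly hk R N a) = aug hk a := by
  have h := mem_augIdeal.1 (versalPoly_sub_mem hk R N a)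
  rw [map_sub, AlgHom.commutes, sub_eq_zero] at h
  exact h

theorem versalPoly_succ_sub_mem (N : ℕ) (a : A) :
    versalPoly hk R (N + 1) a - versalPoly hk R N a ∈ R.ideal N := by
  rw [versalPoly_apply, versalPoly_apply, add_sub_add_left_eq_sub,
    ← Finset.sum_sdiff (Finset.erase_subset_erase 1 (R.B_mono N)), add_sub_cancel_right]
  refine sum_mem fun t ht => smul_mem_twoSidedIdeal _ _ (R.B_new N t ?_)
  simp only [Finset.mem_sdiff, Finset.mem_erase, not_and] at ht ⊢
  exact ⟨ht.1.2, ht.2 ht.1.1⟩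

/-- The coefficient at `u ∈ B̄_N` of the class of `p` in `H̄_N`. -/
def stageCoeff (N : ℕ) (p : FreeAlgebra k (Fin n)) (u : FreeMonoid (Fin n)) : k :=
  if hu : u ∈ R.B N then (R.basis N).repr (R.toStage N p) ⟨u, hu⟩ else 0

theorem toStage_eq_sum (N : ℕ) (p : FreeAlgebra k (Fin n)) :
    R.toStage N p = R.toStage N (∑ u ∈ R.B N, stageCoeff R N p u • mon k u) := by
  conv_lhs => rw [← (R.basis N).sum_repr (R.toStage N p)]
  rw [map_sum, ← Finset.sum_coe_sort (R.B N) fun u => R.toStage N (stageCoeff R N p u • mon k u)]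
  refine Finset.sum_congr rfl fun u _ => ?_
  rw [map_smul, R.basis_apply, stageCoeff, dif_pos u.2]

/-- Since `J_N ⊆ 𝔫`, the augmentation is defined on `H̄_N` and reads off the coefficient at `1`. -/
theorem stageCoeff_one (N : ℕ) {p : FreeAlgebra k (Fin n)} (hp : p ∈ augIdeal k n) :
    stageCoeff R N p 1 = 0 := by
  have hs := mem_augIdeal.1 ((R.isAdmissible N).le_augIdeal
    ((mkₐ_eq_iff _ _ _).1 (toStage_eq_sum R N p)))
  rw [map_sub, mem_augIdeal.1 hp, zero_sub, neg_eq_zero, map_sum, Finset.sum_eq_single 1] at hs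
  · simpa using hs
  · intro u _ hu
    rw [map_smul, mem_augIdeal.1 (mon_mem_augIdeal hu), smul_zero]
  · exact fun h => absurd (R.isAdmissible N).one_mem h

theorem toStage_eq_sum_erase (N : ℕ) {p : FreeAlgebra k (Fin n)} (hp : p ∈ augIdeal k n) :
    R.toStage N p = ∑ u ∈ (R.B N).erase 1, stageCoeff R N p u • R.toStage N (mon k u) := by
  rw [toStage_eq_sum, map_sum, ← Finset.add_sum_erase _ _ (R.isAdmissible N).one_mem,
    stageCoeff_one R N hp, zero_smul, map_zero, zero_add]
  simp only [map_smul]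

/-- This is the equation for `d(v_u)` evaluated at `a ⊗ b`, with the values of the cochains read in
`k`. -/
theorem coef_mul (hx : ∀ i, d1 k A (A ⧸ m) (x i) = 0) (N : ℕ) {u : FreeMonoid (Fin n)}
    (huB : u ∈ R.B N) (hu : u ≠ 1) (a b : A) :
    coef hk R u (a * b) = aug hk a * coef hk R u b + aug hk b * coef hk R u a +
      ∑ s ∈ (R.B N).erase 1, ∑ t ∈ (R.B N).erase 1,
        stageCoeff R N (mon k (s * t)) u * (coef hk R s a * coef hk R t b) := by
  have h := congrArg (fun f : C2 k A (A ⧸ m) => scalar hk (f (a ⊗ₜ b))) (R.d_v_eq hx N ⟨u, huB⟩ hu)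
  have h' : scalar hk (d1 k A (A ⧸ m) (R.v u) (a ⊗ₜ b)) = - ∑ s ∈ (R.B N).erase 1,
      ∑ t ∈ (R.B N).erase 1, stageCoeff R N (mon k (s * t)) u *
        (coef hk R s a * coef hk R t b) := by
    refine h.trans ?_
    simp only [LinearMap.neg_apply, map_neg, LinearMap.sum_apply, LinearMap.smul_apply, map_sum,
      map_smul, smul_eq_mul]
    congr 1
    refine Finset.sum_congr rfl fun s _ => Finset.sum_congr rfl fun t _ => ?_
    rw [stageCoeff, dif_pos huB]
    congr 1
    change scalar hk (R.v t b * R.v s a) = scalar hk (R.v s a) * scalar hk (R.v t b)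
    rw [map_mul, mul_comm]
  rw [scalar_d1] at h'
  change coef hk R u b * _ - coef hk R u (a * b) + _ * coef hk R u a = _ at h'
  linear_combination -h'

theorem toStage_versalPoly_mul (hx : ∀ i, d1 k A (A ⧸ m) (x i) = 0) (N : ℕ) (a b : A) :
    R.toStage N (versalPoly hk R N (a * b)) =
      R.toStage N (versalPoly hk R N a) * R.toStage N (versalPoly hk R N b) := by
  have hT : ∀ c, R.toStage N (versalPoly hk R N c) = aug hk c • (1 : R.stage N) +
      ∑ t ∈ (R.B N).erase 1, coef hk R t c • R.toStage N (mon k t) := by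
    intro c
    rw [versalPoly_apply, map_add, AlgHom.commutes, Algebra.algebraMap_eq_smul_one, map_sum]
    simp only [map_smul]
  rw [hT, hT, hT, map_mul]
  refine smul_one_add_sum_mul _ _ (fun s t u => stageCoeff R N (mon k (s * t)) u) ?_ _ _ _ _ _ ?_
  · intro s _ t ht
    rw [← map_mul, ← map_mul]
    refine toStage_eq_sum_erase R N ?_
    rw [map_mul]
    exact TwoSidedIdeal.mul_mem_left _ _ _ (mon_mem_augIdeal (Finset.ne_of_mem_erase ht))
  · intro u hu
    exact coef_mul hk R hx N (Finset.mem_of_mem_erase hu) (Finset.ne_of_mem_erase hu) a b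

/-- The `v_u` are not assumed to vanish at `1`. But the image of `1` is idempotent by
multiplicativity, and a unit because it is `1` plus a nilpotent element; hence it is `1`. -/
theorem toStage_versalPoly_one (hx : ∀ i, d1 k A (A ⧸ m) (x i) = 0) (N : ℕ) :
    R.toStage N (versalPoly hk R N 1) = 1 := by
  have hq := versalPoly_sub_mem hk R N 1
  set q := versalPoly hk R N 1 - algebraMap k _ (aug hk 1) with hqdef
  have hnil : IsNilpotent (R.toStage N q) :=
    ⟨N + 1, by rw [← map_pow, R.toStage_eq_zero_iff]; exact R.pow_mem_ideal hq N⟩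
  have hunit := hnil.isUnit_one_add
  have hone : R.toStage N (versalPoly hk R N 1) = 1 + R.toStage N q := by
    rw [hqdef, map_one (aug hk), map_one (algebraMap k _), map_sub, map_one (R.toStage N),
      add_sub_cancel]
  rw [← hone] at hunit
  have h := toStage_versalPoly_mul hk R hx N 1 1
  rw [mul_one] at h
  exact (hunit.mul_eq_left.1 h.symm)

/-- The homomorphism `A → H̄_N ⊗ End_k(A/𝔪) = H̄_N`. -/
def versalHom (hx : ∀ i, d1 k A (A ⧸ m) (x i) = 0) (N : ℕ) : A →ₐ[k] R.stage N :=
  AlgHom.ofLinearMap ((R.toStage N).toLinearMap ∘ₗ versalPoly hk R N)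
    (toStage_versalPoly_one hk R hx N) (toStage_versalPoly_mul hk R hx N)

theorem versalHom_apply (hd : ∀ i, d1 k A (A ⧸ m) (x i) = 0) (N : ℕ) (a : A) :
    versalHom hk R hd N a = R.toStage N (versalPoly hk R N a) := rfl

end Representation

end Hochschild

/-! ### Linear algebra of cocycles and of dual families. -/

section Cohomology

variable {k U V W : Type*} [Field k] [AddCommGroup U] [Module k U] [AddCommGroup V] [Module k V]
  [AddCommGroup W] [Module k W] {d0 : U →ₗ[k] V} {d1 : V →ₗ[k] W} {n : ℕ} {x : Fin n → V}

theorem linearIndependent_of_cocycleClass (hx : ∀ i, d1 (x i) = 0)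
    (h : LinearIndependent k fun i => cocycleClass d0 d1 (x i) (hx i)) :
    LinearIndependent k x := by
  have h1 : LinearIndependent k fun i => (⟨x i, hx i⟩ : LinearMap.ker d1) :=
    LinearIndependent.of_comp (Submodule.mkQ _) h
  exact h1.map' (LinearMap.ker d1).subtype (Submodule.ker_subtype _)

theorem exists_sub_sum_mem_range (hx : ∀ i, d1 (x i) = 0)
    (b : Module.Basis (Fin n) k (firstCohomology d0 d1))
    (hb : ∀ i, b i = cocycleClass d0 d1 (x i) (hx i)) {z : V} (hz : d1 z = 0) :
    ∃ c : Fin n → k, (∑ i, c i • x i) - z ∈ LinearMap.range d0 := by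
  refine ⟨b.repr (cocycleClass _ _ z hz), ?_⟩
  have h := b.sum_repr (cocycleClass _ _ z hz)
  simp only [hb] at h
  have h' : Submodule.Quotient.mk (p := (LinearMap.range d0).comap (LinearMap.ker d1).subtype)
      (∑ i, b.repr (cocycleClass _ _ z hz) i • (⟨x i, hx i⟩ : LinearMap.ker d1)) =
      Submodule.Quotient.mk ⟨z, hz⟩ := by
    refine Eq.trans ?_ h
    rw [← Submodule.mkQ_apply, map_sum]
    rfl
  rw [Submodule.Quotient.eq, Submodule.mem_comap, map_sub, map_sum] at h'
  exact h'

theorem exists_basis_cocycleClass (d0 : U →ₗ[k] V) (d1 : V →ₗ[k] W)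
    [FiniteDimensional k (firstCohomology d0 d1)] :
    ∃ (n : ℕ) (x : Fin n → V) (hx : ∀ i, d1 (x i) = 0)
      (b : Module.Basis (Fin n) k (firstCohomology d0 d1)),
      ∀ i, b i = cocycleClass d0 d1 (x i) (hx i) := by
  let b := Module.finBasis k (firstCohomology d0 d1)
  choose z hz using fun i => Submodule.Quotient.mk_surjective _ (b i)
  exact ⟨_, fun i => (z i).1, fun i => (z i).2, b, fun i => (hz i).symm⟩

theorem exists_eq_of_linearIndependent {l : Fin n → V →ₗ[k] k} (hl : LinearIndependent k l)
    (c : Fin n → k) : ∃ a, ∀ i, l i a = c i := by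
  have hsurj : LinearMap.range (LinearMap.pi l) = ⊤ := by
    -- A nonzero functional on `kⁿ` killing the image would be a linear relation among the `l i`.
    by_contra hne
    obtain ⟨f, hf, hle⟩ := Submodule.exists_le_ker_of_lt_top _ (lt_top_iff_ne_top.2 hne)
    refine hf (LinearMap.pi_ext' fun i => LinearMap.ext_ring ?_)
    have h0 : ∑ i, f (Pi.single i 1) • l i = 0 := by
      refine LinearMap.ext fun a => ?_
      have h := LinearMap.mem_ker.1 (hle ⟨a, rfl⟩)
      rw [LinearMap.pi_apply_eq_sum_univ] at h
      rw [LinearMap.sum_apply, LinearMap.zero_apply, ← h]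
      refine Finset.sum_congr rfl fun i _ => ?_
      rw [LinearMap.smul_apply, LinearMap.pi_apply, smul_eq_mul, smul_eq_mul, mul_comm]
      congr 2
      ext j
      simp [Pi.single_apply, eq_comm]
    exact Fintype.linearIndependent_iff.1 hl _ h0 i
  obtain ⟨a, ha⟩ := LinearMap.range_eq_top.1 hsurj c
  exact ⟨a, congrFun ha⟩

end Cohomology

/-! ### `Ext¹` as the dual of `𝔪/𝔪²`. -/

namespace Hochschild

open GMMPAlgebra

section ExtBasis

variable {k A M : Type*} [Field k] [Ring A] [Algebra k A] [AddCommGroup M] [Module k M]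
  [Module Aᵐᵒᵖ M] [IsScalarTower k Aᵐᵒᵖ M] {n : ℕ} {x : Fin n → C1 k A M}

variable (k A M) in
theorem exists_isExtBasis [FiniteDimensional k (Ext1 k A M)] :
    ∃ (n : ℕ) (x : Fin n → C1 k A M), IsExtBasis k A M x := by
  obtain ⟨n, x, h⟩ := exists_basis_cocycleClass (d0 k A M) (d1 k A M)
  exact ⟨n, x, h⟩

theorem IsExtBasis.d1_eq_zero (hx : IsExtBasis k A M x) (i : Fin n) : d1 k A M (x i) = 0 :=
  hx.choose i

theorem IsExtBasis.eq_zero_of_sum (hx : IsExtBasis k A M x) {c : Fin n → k}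
    (hc : ∀ a, ∑ i, c i • x i a = 0) (i : Fin n) : c i = 0 := by
  obtain ⟨hd, b, hb⟩ := hx
  have h := b.linearIndependent
  rw [funext hb] at h
  refine Fintype.linearIndependent_iff.1 (linearIndependent_of_cocycleClass hd h) c ?_ i
  refine LinearMap.ext fun a => ?_
  rw [LinearMap.sum_apply, LinearMap.zero_apply, ← hc a]
  rfl

/-- If there are no coboundaries, then every cocycle is a linear combination of the `xᵢ`. -/
theorem IsExtBasis.exists_eq_sum (hx : IsExtBasis k A M x) (h0 : d0 k A M = 0) {φ : C1 k A M}
    (hφ : d1 k A M φ = 0) : ∃ c : Fin n → k, ∀ a, φ a = ∑ i, c i • x i a := by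
  obtain ⟨hd, b, hb⟩ := hx
  obtain ⟨c, u, hu⟩ := exists_sub_sum_mem_range hd b hb hφ
  rw [h0, LinearMap.zero_apply, eq_comm, sub_eq_zero] at hu
  refine ⟨c, fun a => ?_⟩
  rw [← hu, LinearMap.sum_apply]
  rfl

end ExtBasis

section Tangent

variable {k A : Type*} [Field k] [CommRing A] [Algebra k A] {m : Ideal A}
  (hk : Function.Bijective (algebraMap k (A ⧸ m))) {n : ℕ} {x : Fin n → C1 k A (A ⧸ m)}

theorem scalar_cocycle_one {φ : C1 k A (A ⧸ m)} (hφ : d1 k A (A ⧸ m) φ = 0) :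
    scalar hk (φ 1) = 0 := by
  have h := scalar_d1 hk φ 1 1
  rw [hφ, LinearMap.zero_apply, map_zero, map_one (aug hk), mul_one, mul_one, one_mul, sub_self,
    zero_add] at h
  exact h.symm

theorem IsExtBasis.exists_dual (hx : IsExtBasis k A (A ⧸ m) x) (c : Fin n → k) :
    ∃ a, aug hk a = 0 ∧ ∀ i, scalar hk (x i a) = c i := by
  let l : Fin n → A →ₗ[k] k := fun i => (scalar hk).toLinearMap ∘ₗ x i
  have hl : LinearIndependent k l := by
    rw [Fintype.linearIndependent_iff]
    intro g hg
    refine hx.eq_zero_of_sum fun a => scalar_injective hk ?_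
    have h := LinearMap.congr_fun hg a
    rw [LinearMap.sum_apply] at h
    rw [map_sum, map_zero]
    refine Eq.trans (Finset.sum_congr rfl fun i _ => ?_) h
    rw [map_smul]
    rfl
  obtain ⟨a, ha⟩ := exists_eq_of_linearIndependent hl c
  -- Cocycles vanish on scalars, so moving `a` into `𝔪` does not change the values of the `x i`.
  refine ⟨a - algebraMap k A (aug hk a), (aug_eq_zero_iff hk).2 (sub_aug_mem hk a), fun i => ?_⟩
  rw [Algebra.algebraMap_eq_smul_one, map_sub, map_smul, map_sub, map_smul,
    scalar_cocycle_one hk (hx.d1_eq_zero i), smul_zero, sub_zero]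
  exact ha i

/-- An element of `𝔪` on which all `xᵢ` vanish lies in `𝔪²`. -/
theorem IsExtBasis.mem_sq (hx : IsExtBasis k A (A ⧸ m) x) {a : A} (ha : a ∈ m)
    (h : ∀ i, scalar hk (x i a) = 0) : a ∈ m ^ 2 := by
  by_contra hn
  -- A functional killing `𝔪²` but not `a` gives a cocycle, hence a combination of the `x i`, which
  -- vanishes at `a`.
  obtain ⟨l, hla, hl⟩ := Submodule.exists_le_ker_of_notMem
    (p := (m ^ 2).restrictScalars k) (v := a) (by rwa [Submodule.restrictScalars_mem])
  have hd : d1 k A (A ⧸ m) (ofFunctional (reduced hk l)) = 0 := by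
    refine C2_ext hk fun a b => ?_
    rw [scalar_d1_reduced, LinearMap.zero_apply, map_zero, neg_eq_zero]
    refine LinearMap.mem_ker.1 (hl ?_)
    rw [Submodule.restrictScalars_mem, sq]
    exact Ideal.mul_mem_mul (sub_aug_mem hk a) (sub_aug_mem hk b)
  obtain ⟨c, hc⟩ := hx.exists_eq_sum (d0_eq_zero hk) hd
  refine hla ?_
  have h1 := scalar_ofFunctional hk (reduced hk l) a
  rw [reduced_apply, (aug_eq_zero_iff hk).2 ha, map_zero, sub_zero, hc] at h1
  rw [← h1, map_sum]
  refine Finset.sum_eq_zero fun i _ => ?_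
  rw [map_smul, h, smul_zero]

end Tangent

/-! ### `φ_N` kills `𝔪^{N+1}` and hits the variables. -/

section Versal

variable {k A : Type*} [Field k] [CommRing A] [Algebra k A] {m : Ideal A}
  (hk : Function.Bijective (algebraMap k (A ⧸ m))) {n : ℕ} {x : Fin n → C1 k A (A ⧸ m)}
  (R : MasseyData (gmmp k A (A ⧸ m)) x) (hd : ∀ i, d1 k A (A ⧸ m) (x i) = 0)

theorem versalHom_eq_succ (N : ℕ) (a : A) :
    versalHom hk R hd N a = R.toStage N (versalPoly hk R (N + 1) a) := by
  rw [versalHom_apply, eq_comm, mkₐ_eq_iff]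
  exact versalPoly_succ_sub_mem hk R N a

theorem versalPoly_mem_augIdeal (N : ℕ) {a : A} (ha : a ∈ m) :
    versalPoly hk R N a ∈ augIdeal k n := by
  rw [mem_augIdeal, lift_versalPoly, aug_eq_zero_iff]
  exact ha

theorem versalHom_eq_zero (N : ℕ) {a : A} (ha : a ∈ m ^ (N + 1)) :
    versalHom hk R hd N a = 0 := by
  induction N generalizing a with
  | zero =>
    rw [zero_add, pow_one] at ha
    exact (R.toStage_eq_zero_iff 0 _).2 (versalPoly_mem_augIdeal hk R 0 ha)
  | succ N ih =>
    rw [pow_succ] at ha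
    refine Submodule.mul_induction_on ha (fun b hb c hc => ?_) fun b c hb hc => ?_
    · have h1 := ih hb
      -- With the polynomial of stage `N + 1` as representative, `h1` puts the image of `b` in
      -- `J_N`, and `J_N 𝔫 ⊆ J_{N+1}`.
      rw [versalHom_eq_succ, R.toStage_eq_zero_iff] at h1
      rw [map_mul, versalHom_apply, versalHom_apply, ← map_mul, R.toStage_eq_zero_iff]
      exact R.mul_mem_ideal' (versalPoly_mem_augIdeal hk R _ hc) h1
    · rw [map_add, hb, hc, add_zero]

theorem mem_of_versalHom_eq_zero {N : ℕ} {a : A} (h : versalHom hk R hd N a = 0) :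
    a ∈ m := by
  rw [versalHom_apply, R.toStage_eq_zero_iff] at h
  have h1 := mem_augIdeal.1 ((R.isAdmissible N).le_augIdeal h)
  rwa [lift_versalPoly, aug_eq_zero_iff] at h1

theorem versalHom_eq_zero_of_succ {N : ℕ} {a : A}
    (h : versalHom hk R hd (N + 1) a = 0) : versalHom hk R hd N a = 0 := by
  rw [versalHom_apply, R.toStage_eq_zero_iff] at h
  rw [versalHom_eq_succ, R.toStage_eq_zero_iff]
  exact R.ideal_succ_le N h

theorem coef_eq_zero {N : ℕ} {a : A} (h : versalHom hk R hd N a = 0)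
    {u : FreeMonoid (Fin n)} (huB : u ∈ R.B N) (hu : u ≠ 1) : coef hk R u a = 0 := by
  have ha := (aug_eq_zero_iff hk).2 (mem_of_versalHom_eq_zero hk R hd h)
  rw [versalHom_apply, versalPoly_apply, ha, map_zero, zero_add, map_sum] at h
  have h0 := linearIndepOn_finset_iff.1 (R.isAdmissible N).linearIndepOn
    -- The coefficient at `1` is `ε(a)`, which is zero here.
    (fun u => if u = 1 then 0 else coef hk R u a) (by
      rw [← Finset.add_sum_erase _ _ (R.isAdmissible N).one_mem, if_pos rfl, zero_smul, zero_add,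
        ← h]
      refine Finset.sum_congr rfl fun t ht => ?_
      rw [if_neg (Finset.ne_of_mem_erase ht), map_smul]) u huB
  rwa [if_neg hu] at h0

theorem mem_ideal_one {p : FreeAlgebra k (Fin n)} (hp : p ∈ R.ideal 1) :
    p ∈ Submodule.span k {p | ∃ a ∈ augIdeal k n, ∃ b ∈ augIdeal k n, p = a * b} := by
  refine span_le_of_stable _ ?_ ?_ ?_ hp
  · rintro _ (⟨a, ha, b, hb, rfl | rfl⟩ | ⟨i, rfl⟩)
    · exact Submodule.subset_span ⟨a, ha, b, hb, rfl⟩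
    · exact Submodule.subset_span ⟨b, hb, a, ha, rfl⟩
    · rw [R.B_zero, relationPoly_singleton_one]
      exact zero_mem _
  · intro i p hp
    induction hp using Submodule.span_induction with
    | mem _ h =>
      obtain ⟨a, ha, b, hb, rfl⟩ := h
      exact Submodule.subset_span
        ⟨_ * a, TwoSidedIdeal.mul_mem_left _ _ _ ha, b, hb, (mul_assoc _ _ _).symm⟩
    | zero => rw [mul_zero]; exact zero_mem _
    | add a b _ _ ha hb => rw [mul_add]; exact add_mem ha hb
    | smul r a _ ha => rw [mul_smul_comm]; exact Submodule.smul_mem _ _ ha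
  · intro i p hp
    induction hp using Submodule.span_induction with
    | mem _ h =>
      obtain ⟨a, ha, b, hb, rfl⟩ := h
      exact Submodule.subset_span
        ⟨a, ha, b * _, TwoSidedIdeal.mul_mem_right _ _ _ hb, mul_assoc _ _ _⟩
    | zero => rw [zero_mul]; exact zero_mem _
    | add a b _ _ ha hb => rw [add_mul]; exact add_mem ha hb
    | smul r a _ ha => rw [smul_mul_assoc]; exact Submodule.smul_mem _ _ ha

theorem ideal_le_ideal_one (N : ℕ) : R.ideal (N + 1) ≤ R.ideal 1 := by
  induction N with
  | zero => exact le_rfl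
  | succ N ih => exact (R.ideal_succ_le (N + 1)).trans ih

/-- Preimages of the variables in `A` define a lift of the free algebra to `A`. -/
theorem versalHom_lift {N : ℕ} {a : Fin n → A}
    (ha : ∀ i, versalHom hk R hd N (a i) = R.toStage N (FreeAlgebra.ι k i))
    (p : FreeAlgebra k (Fin n)) :
    versalHom hk R hd N (FreeAlgebra.lift k a p) = R.toStage N p := by
  have h : (versalHom hk R hd N).comp (FreeAlgebra.lift k a) = R.toStage N := by
    refine FreeAlgebra.hom_ext (funext fun i => ?_)
    simp [ha]
  exact congrArg (fun f : FreeAlgebra k (Fin n) →ₐ[k] R.stage N => f p) h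

theorem exists_versalHom_eq_ι (hx : IsExtBasis k A (A ⧸ m) x) (N : ℕ) (i : Fin n) :
    ∃ a, versalHom hk R hd N a = R.toStage N (FreeAlgebra.ι k i) := by
  induction N generalizing i with
  | zero =>
    refine ⟨0, ?_⟩
    rw [map_zero, eq_comm, R.toStage_eq_zero_iff, ← mon_of]
    exact mon_mem_augIdeal (FreeMonoid.of_ne_one i)
  | succ N ih =>
    rcases N with _ | N
    · obtain ⟨a, ha, hxa⟩ := hx.exists_dual hk (Pi.single i 1)
      refine ⟨a, ?_⟩
      have hB : (R.B (0 + 1)).erase 1 = Finset.univ.image FreeMonoid.of := by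
        rw [show R.B (0 + 1) = _ from R.B_one, Finset.erase_insert]
        simp [FreeMonoid.of_ne_one]
      rw [versalHom_apply, versalPoly_apply, ha, map_zero, hB,
        Finset.sum_image FreeMonoid.of_injective.injOn, Finset.sum_eq_single i]
      · rw [coef, R.v_of, LinearMap.comp_apply, AlgHom.toLinearMap_apply, hxa, Pi.single_eq_same,
          one_smul, mon_of]
        exact congrArg _ (zero_add _)
      · intro j _ hj
        rw [coef, R.v_of, LinearMap.comp_apply, AlgHom.toLinearMap_apply, hxa,
          Pi.single_eq_of_ne hj, zero_smul]
      · exact fun h => absurd (Finset.mem_univ _) h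
    · choose a ha using ih
      have hlift := versalHom_lift hk R hd ha
      have hsub : ∀ p, versalPoly hk R (N + 1 + 1) (FreeAlgebra.lift k a p) - p ∈
          R.ideal (N + 1) := by
        intro p
        rw [← mkₐ_eq_iff]
        exact (versalHom_eq_succ hk R hd (N + 1) _).symm.trans (hlift p)
      have hsq : ∀ p ∈ Submodule.span k {p | ∃ a ∈ augIdeal k n, ∃ b ∈ augIdeal k n, p = a * b},
          ∃ b, versalHom hk R hd (N + 1 + 1) b = R.toStage (N + 1 + 1) p := by
        intro p hp
        induction hp using Submodule.span_induction with
        | mem _ h =>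
          obtain ⟨b, hb, c, hc, rfl⟩ := h
          refine ⟨FreeAlgebra.lift k a b * FreeAlgebra.lift k a c, ?_⟩
          rw [map_mul, versalHom_apply, versalHom_apply, ← map_mul,
            mkₐ_eq_iff]
          set b' := versalPoly hk R (N + 1 + 1) (FreeAlgebra.lift k a b)
          set c' := versalPoly hk R (N + 1 + 1) (FreeAlgebra.lift k a c)
          have hc' : c' ∈ augIdeal k n := by
            have := TwoSidedIdeal.add_mem _ ((R.isAdmissible _).le_augIdeal (hsub c)) hc
            rwa [sub_add_cancel] at this
          -- Each error lies in `J_{N+1}` and is multiplied by an element of `𝔫`, so the product is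
          -- exact at stage `N + 2`.
          rw [show b' * c' - b * c = (b' - b) * c' + b * (c' - c) by noncomm_ring]
          exact TwoSidedIdeal.add_mem _ (R.mul_mem_ideal' hc' (hsub b))
            (R.mul_mem_ideal hb (hsub c))
        | zero => exact ⟨0, by rw [map_zero, map_zero]⟩
        | add b c _ _ ihb ihc =>
          obtain ⟨b', hb'⟩ := ihb
          obtain ⟨c', hc'⟩ := ihc
          exact ⟨b' + c', by rw [map_add, map_add, hb', hc']⟩
        | smul r b _ ih =>
          obtain ⟨b', hb'⟩ := ih
          exact ⟨r • b', by rw [map_smul, map_smul, hb']⟩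
      -- The error at the variable lies in `J_{N+1} ⊆ J_1 = 𝔫²`, so it has an exact preimage `b`,
      -- which is subtracted from `a i`.
      obtain ⟨b, hb⟩ := hsq _
        (mem_ideal_one R (ideal_le_ideal_one R N (hsub (FreeAlgebra.ι k i))))
      refine ⟨a i - b, ?_⟩
      rw [map_sub, FreeAlgebra.lift_ι_apply] at hb
      rw [map_sub, hb, versalHom_apply, sub_sub_cancel]

end Versal

end Hochschild

/-! ### Vanishing of obstructions and the kernel of `φ_N`. -/

namespace GMMPAlgebra

theorem sum_coord_eq_zero {k V W : Type*} [Field k] [AddCommGroup V] [Module k V]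
    [AddCommGroup W] [Module k W] {L : GMMPAlgebra k V W} {I : Set (W ⧸ LinearMap.range L.d)}
    (y : Module.Basis I k (W ⧸ LinearMap.range L.d)) {ι : Type*} (S : Finset ι) (v : ι → V)
    (c : ι → ι → k) {z : V}
    (hz : L.d z = - ∑ s ∈ S, ∑ t ∈ S, c s t • L.cup (v s ⊗ₜ[k] v t)) (i : I) :
    ∑ s ∈ S, ∑ t ∈ S, y.coord i (Submodule.Quotient.mk (L.cup (v s ⊗ₜ[k] v t))) * c s t = 0 := by
  have h : (LinearMap.range L.d).mkQ (- L.d z) = 0 := by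
    rw [Submodule.mkQ_apply, Submodule.Quotient.mk_eq_zero]
    exact neg_mem ⟨z, rfl⟩
  have h' := congrArg (y.coord i) h
  rw [hz, neg_neg, map_zero] at h'
  rw [← h']
  simp only [map_sum, map_smul, smul_eq_mul, Submodule.mkQ_apply]
  exact Finset.sum_congr rfl fun s _ => Finset.sum_congr rfl fun t _ => mul_comm _ _

end GMMPAlgebra

namespace Hochschild

open GMMPAlgebra

section Kernel

variable {k A : Type*} [Field k] [CommRing A] [Algebra k A] {m : Ideal A}
  (hk : Function.Bijective (algebraMap k (A ⧸ m))) {n : ℕ} {x : Fin n → C1 k A (A ⧸ m)}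
  (R : MasseyData (gmmp k A (A ⧸ m)) x) (hd : ∀ i, d1 k A (A ⧸ m) (x i) = 0)

theorem ker_versalHom_zero {a : A} (h : versalHom hk R hd 0 a = 0) : a ∈ m ^ (0 + 1) := by
  rw [zero_add, pow_one]
  exact mem_of_versalHom_eq_zero hk R hd h

/-- At stage `1` the coefficients at the variables are the values `x i a`. -/
theorem ker_versalHom_one (hx : IsExtBasis k A (A ⧸ m) x) {a : A}
    (h : versalHom hk R hd 1 a = 0) : a ∈ m ^ (1 + 1) := by
  refine hx.mem_sq hk (mem_of_versalHom_eq_zero hk R hd h) fun i => ?_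
  have h1 : FreeMonoid.of i ∈ R.B 1 := by
    rw [R.B_one]
    exact mem_shortWords.2 (Or.inr ⟨i, rfl⟩)
  have h2 := coef_eq_zero hk R hd h h1 (FreeMonoid.of_ne_one i)
  rwa [coef, R.v_of] at h2

section Step

variable {N : ℕ} {g : FreeAlgebra k (Fin n) →ₐ[k] A}
  (hg : ∀ p, versalHom hk R hd (N + 1) (g p) = R.toStage (N + 1) p)

include hg

theorem versalHom_lift_pred (p : FreeAlgebra k (Fin n)) :
    versalHom hk R hd N (g p) = R.toStage N p := by
  rw [versalHom_eq_succ, mkₐ_eq_iff]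
  refine R.ideal_succ_le N ?_
  rw [← mkₐ_eq_iff]
  exact hg p

theorem lift_mem {p : FreeAlgebra k (Fin n)} (hp : p ∈ augIdeal k n) : g p ∈ m := by
  have h : versalPoly hk R (N + 1) (g p) - p ∈ R.ideal (N + 1) := (mkₐ_eq_iff _ _ _).1 (hg p)
  have h1 := TwoSidedIdeal.add_mem _ ((R.isAdmissible _).le_augIdeal h) hp
  rwa [sub_add_cancel, mem_augIdeal, lift_versalPoly, aug_eq_zero_iff] at h1

variable (hker : ∀ a, versalHom hk R hd N a = 0 → a ∈ m ^ (N + 1))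

include hker

theorem sub_lift_versalPoly_mem (a : A) : a - g (versalPoly hk R N a) ∈ m ^ (N + 1) := by
  refine hker _ ?_
  rw [map_sub, versalHom_lift_pred hk R hd hg, versalHom_apply, sub_self]

/-- The double sum is the product of the `g`-approximations to the `𝔪`-components of `a` and `b`.
Each approximation has error in `𝔪^{N+1}`, and in the difference of products each error is
multiplied by an element of `𝔪`. -/
theorem mul_sub_sum_mem (a b : A) :
    (a - algebraMap k A (aug hk a)) * (b - algebraMap k A (aug hk b)) -
      ∑ s ∈ (R.B N).erase 1, ∑ t ∈ (R.B N).erase 1,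
        (coef hk R s a * coef hk R t b) • g (mon k (s * t)) ∈ m ^ (N + 1 + 1) := by
  have hq : ∀ c, ∑ s ∈ (R.B N).erase 1, coef hk R s c • g (mon k s) =
      g (versalPoly hk R N c - algebraMap k _ (aug hk c)) := by
    intro c
    rw [versalPoly_apply, add_sub_cancel_left, map_sum]
    simp only [map_smul]
  have hw := sub_lift_versalPoly_mem hk R hd hg hker
  have hprod : ∑ s ∈ (R.B N).erase 1, ∑ t ∈ (R.B N).erase 1,
      (coef hk R s a * coef hk R t b) • g (mon k (s * t)) =
      g (versalPoly hk R N a - algebraMap k _ (aug hk a)) *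
        g (versalPoly hk R N b - algebraMap k _ (aug hk b)) := by
    rw [← hq, ← hq, Finset.sum_mul_sum]
    refine Finset.sum_congr rfl fun s _ => Finset.sum_congr rfl fun t _ => ?_
    rw [smul_mul_smul_comm, map_mul, map_mul]
  have hα := lift_mem hk R hd hg (versalPoly_sub_mem hk R N a)
  have hb := sub_aug_mem hk b
  have key : (a - algebraMap k A (aug hk a)) * (b - algebraMap k A (aug hk b)) -
      g (versalPoly hk R N a - algebraMap k _ (aug hk a)) *
        g (versalPoly hk R N b - algebraMap k _ (aug hk b)) =
      (b - g (versalPoly hk R N b)) * g (versalPoly hk R N a - algebraMap k _ (aug hk a)) +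
        (a - g (versalPoly hk R N a)) * (b - algebraMap k A (aug hk b)) := by
    simp only [map_sub, AlgHom.commutes]
    ring
  rw [hprod, key, pow_succ m (N + 1)]
  exact add_mem (Ideal.mul_mem_mul (hw b) hα) (Ideal.mul_mem_mul (hw a) hb)

/-- The obstructions vanish in `A/𝔪^{N+2}`. -/
theorem lift_relationPoly_mem (i : R.I) :
    g ((gmmp k A (A ⧸ m)).relationPoly R.y (R.B N) R.v i) ∈ m ^ (N + 1 + 1) := by
  by_contra hn
  obtain ⟨l, hla, hl⟩ := Submodule.exists_le_ker_of_notMem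
    (p := (m ^ (N + 1 + 1)).restrictScalars k)
    (v := g ((gmmp k A (A ⧸ m)).relationPoly R.y (R.B N) R.v i))
    (by rwa [Submodule.restrictScalars_mem])
  have hd1 : (gmmp k A (A ⧸ m)).d (ofFunctional (reduced hk l)) =
      - ∑ s ∈ (R.B N).erase 1, ∑ t ∈ (R.B N).erase 1,
        l (g (mon k (s * t))) • (gmmp k A (A ⧸ m)).cup (R.v s ⊗ₜ[k] R.v t) := by
    refine C2_ext hk fun a b => ?_
    have h1 := LinearMap.mem_ker.1 (hl (mul_sub_sum_mem hk R hd hg hker a b))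
    rw [map_sub, sub_eq_zero] at h1
    refine (scalar_d1_reduced hk l a b).trans ?_
    rw [h1]
    simp only [LinearMap.neg_apply, map_neg, LinearMap.sum_apply, LinearMap.smul_apply, map_sum,
      map_smul, smul_eq_mul]
    congr 1
    refine Finset.sum_congr rfl fun s _ => Finset.sum_congr rfl fun t _ => ?_
    rw [mul_comm]
    congr 1
    change scalar hk (R.v s a) * scalar hk (R.v t b) = scalar hk (R.v t b * R.v s a)
    rw [map_mul, mul_comm]
  refine hla ?_
  -- By `hd1` the sum is a coboundary, so its `i`-th coordinate vanishes; that coordinate is `l` of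
  -- the lifted relation.
  rw [← sum_coord_eq_zero R.y _ R.v _ hd1 i, relationPoly]
  simp only [map_sum, map_smul, smul_eq_mul]

theorem lift_ideal_succ_mem {p : FreeAlgebra k (Fin n)} (hp : p ∈ R.ideal (N + 1)) :
    g p ∈ m ^ (N + 1 + 1) := by
  have hJ : ∀ q ∈ R.ideal N, g q ∈ m ^ (N + 1) := fun q hq => hker _ (by
    rw [versalHom_lift_pred hk R hd hg, R.toStage_eq_zero_iff]
    exact hq)
  rw [← Ideal.Quotient.eq_zero_iff_mem]
  change ((Ideal.Quotient.mk (m ^ (N + 1 + 1))).comp g.toRingHom) p = 0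
  rw [← TwoSidedIdeal.mem_ker]
  refine (nextIdeal_le ?_ ?_ ?_ : R.ideal (N + 1) ≤ _) hp
  · intro a ha b hb
    rw [TwoSidedIdeal.mem_ker]
    refine Ideal.Quotient.eq_zero_iff_mem.2 ?_
    change g (a * b) ∈ _
    rw [map_mul, pow_succ']
    exact Ideal.mul_mem_mul (lift_mem hk R hd hg ha) (hJ b hb)
  · intro a ha b hb
    rw [TwoSidedIdeal.mem_ker]
    refine Ideal.Quotient.eq_zero_iff_mem.2 ?_
    change g (b * a) ∈ _
    rw [map_mul, pow_succ]
    exact Ideal.mul_mem_mul (hJ b hb) (lift_mem hk R hd hg ha)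
  · intro i
    rw [TwoSidedIdeal.mem_ker]
    exact Ideal.Quotient.eq_zero_iff_mem.2 (lift_relationPoly_mem hk R hd hg hker i)

/-- Write `a` as a sum of products `b c` with `b ∈ 𝔪^N`, `c ∈ 𝔪`, and approximate both factors by
`g`. The condition `N ≠ 0` puts `b` in `𝔪`, so that the error of `c` is also multiplied by an
element of `𝔪`. -/
theorem exists_sub_lift_mem (hN : N ≠ 0) {a : A} (ha : a ∈ m ^ (N + 1)) :
    ∃ p, a - g p ∈ m ^ (N + 1 + 1) := by
  have hw := sub_lift_versalPoly_mem hk R hd hg hker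
  rw [pow_succ] at ha
  refine Submodule.mul_induction_on ha (fun b hb c hc => ?_) fun b c hb hc => ?_
  · refine ⟨versalPoly hk R N b * versalPoly hk R N c, ?_⟩
    have hb' : g (versalPoly hk R N b) ∈ m := by
      rw [← sub_sub_cancel b (g (versalPoly hk R N b))]
      exact sub_mem (Ideal.pow_le_self hN hb) (Ideal.pow_le_self N.succ_ne_zero (hw b))
    rw [map_mul, show b * c - g (versalPoly hk R N b) * g (versalPoly hk R N c) =
      (b - g (versalPoly hk R N b)) * c + (c - g (versalPoly hk R N c)) *
        g (versalPoly hk R N b) by ring, pow_succ m (N + 1)]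
    exact add_mem (Ideal.mul_mem_mul (hw b) hc) (Ideal.mul_mem_mul (hw c) hb')
  · obtain ⟨p, hp⟩ := hb
    obtain ⟨q, hq⟩ := hc
    exact ⟨p + q, by rw [map_add, add_sub_add_comm]; exact add_mem hp hq⟩

theorem ker_versalHom_succ (hN : N ≠ 0) {a : A} (h : versalHom hk R hd (N + 1) a = 0) :
    a ∈ m ^ (N + 1 + 1) := by
  obtain ⟨p, hp⟩ := exists_sub_lift_mem hk R hd hg hker hN
    (hker a (versalHom_eq_zero_of_succ hk R hd h))
  have h1 := versalHom_eq_zero hk R hd (N + 1) hp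
  rw [map_sub, h, zero_sub, neg_eq_zero, hg, R.toStage_eq_zero_iff] at h1
  have h2 := add_mem hp (lift_ideal_succ_mem hk R hd hg hker h1)
  rwa [sub_add_cancel] at h2

end Step

theorem mem_pow_of_versalHom_eq_zero (hx : IsExtBasis k A (A ⧸ m) x) (N : ℕ) (a : A)
    (h : versalHom hk R hd N a = 0) : a ∈ m ^ (N + 1) := by
  induction N generalizing a with
  | zero => exact ker_versalHom_zero hk R hd h
  | succ N ih =>
    rcases eq_or_ne N 0 with rfl | hN
    · exact ker_versalHom_one hk R hd hx h
    · choose b hb using exists_versalHom_eq_ι hk R hd hx (N + 1)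
      exact ker_versalHom_succ hk R hd (versalHom_lift hk R hd hb) ih hN h

theorem versalHom_surjective (hx : IsExtBasis k A (A ⧸ m) x) (N : ℕ) :
    Function.Surjective (versalHom hk R hd N) := by
  intro z
  obtain ⟨p, rfl⟩ := R.toStage_surjective N z
  choose b hb using exists_versalHom_eq_ι hk R hd hx N
  exact ⟨_, versalHom_lift hk R hd hb p⟩

end Kernel

end Hochschild

/-! ### Passage to the limit and to endomorphisms. -/

namespace Hochschild

open GMMPAlgebra

section Completion

variable {k A : Type*} [Field k] [CommRing A] [Algebra k A] {m : Ideal A}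
  (hk : Function.Bijective (algebraMap k (A ⧸ m))) {n : ℕ} {x : Fin n → C1 k A (A ⧸ m)}
  (R : MasseyData (gmmp k A (A ⧸ m)) x)

/-- The map `A/𝔪^{N+1} → H̄_N`. -/
def truncHom (hd : ∀ i, d1 k A (A ⧸ m) (x i) = 0) (N : ℕ) :
    (A ⧸ m ^ (N + 1)) →ₐ[k] R.stage N :=
  Ideal.Quotient.liftₐ _ (versalHom hk R hd N) fun _ ha => versalHom_eq_zero hk R hd N ha

theorem truncHom_mk (hd : ∀ i, d1 k A (A ⧸ m) (x i) = 0) (N : ℕ) (a : A) :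
    truncHom hk R hd N (Ideal.Quotient.mk _ a) = versalHom hk R hd N a := rfl

theorem truncHom_injective (hx : IsExtBasis k A (A ⧸ m) x) (N : ℕ) :
    Function.Injective (truncHom hk R hx.d1_eq_zero N) := by
  rw [injective_iff_map_eq_zero]
  intro z hz
  obtain ⟨a, rfl⟩ := Ideal.Quotient.mk_surjective z
  exact Ideal.Quotient.eq_zero_iff_mem.2 (mem_pow_of_versalHom_eq_zero hk R hx.d1_eq_zero hx N a hz)

theorem evalₐ_pred {N : ℕ} {z : AdicCompletion m A} {a : A}
    (h : AdicCompletion.evalₐ m (N + 1) z = Ideal.Quotient.mk _ a) :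
    AdicCompletion.evalₐ m N z = Ideal.Quotient.mk _ a := by
  obtain ⟨f, rfl⟩ := AdicCompletion.mk_surjective m A z
  rw [AdicCompletion.evalₐ_mk, Ideal.Quotient.eq] at h
  rw [AdicCompletion.evalₐ_mk, ← AdicCompletion.Ideal.mk_eq_mk m (Nat.le_succ N),
    Ideal.Quotient.eq]
  exact Ideal.pow_le_pow_right (Nat.le_succ N) h

/-- The map from the `𝔪`-adic completion to the formal algebra. -/
def completionHom (hd : ∀ i, d1 k A (A ⧸ m) (x i) = 0) :
    AdicCompletion m A →ₐ[k] R.formalAlgebra :=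
  AlgHom.codRestrict
    (AlgHom.pi fun N => (truncHom hk R hd N).comp
      ((AdicCompletion.evalₐ m (N + 1)).restrictScalars k))
    R.formalAlgebra (by
      intro z N
      obtain ⟨a, ha⟩ := Ideal.Quotient.mk_surjective (AdicCompletion.evalₐ m (N + 1 + 1) z)
      refine ⟨versalPoly hk R (N + 1) a, ?_, ?_⟩
      · change _ = truncHom hk R hd (N + 1) (AdicCompletion.evalₐ m (N + 1 + 1) z)
        rw [← ha]
        rfl
      · change _ = truncHom hk R hd N (AdicCompletion.evalₐ m (N + 1) z)
        rw [evalₐ_pred ha.symm, truncHom_mk, versalHom_eq_succ])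

theorem completionHom_apply (hd : ∀ i, d1 k A (A ⧸ m) (x i) = 0) (z : AdicCompletion m A)
    (N : ℕ) : (completionHom hk R hd z).1 N =
      truncHom hk R hd N (AdicCompletion.evalₐ m (N + 1) z) := rfl

theorem completionHom_bijective (hx : IsExtBasis k A (A ⧸ m) x) :
    Function.Bijective (completionHom hk R hx.d1_eq_zero) := by
  constructor
  · intro z w h
    have hN : ∀ N, AdicCompletion.evalₐ m (N + 1) z = AdicCompletion.evalₐ m (N + 1) w := by
      intro N
      refine truncHom_injective hk R hx N ?_
      rw [← completionHom_apply, ← completionHom_apply, h]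
    -- `H̄_N` sees level `N + 1` of the completion, so level `N` is recovered from the level above
    -- it.
    refine AdicCompletion.ext_evalₐ fun N => ?_
    obtain ⟨a, ha⟩ := Ideal.Quotient.mk_surjective (AdicCompletion.evalₐ m (N + 1) z)
    rw [evalₐ_pred ha.symm, evalₐ_pred ((hN N).symm.trans ha.symm)]
  · intro h
    choose a ha using fun N => versalHom_surjective hk R hx.d1_eq_zero hx N (h.1 N)
    have hsucc : ∀ N, versalHom hk R hx.d1_eq_zero N (a (N + 1)) = h.1 N := by
      intro N
      obtain ⟨p, hp, hp'⟩ := h.2 N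
      rw [← hp', versalHom_eq_succ, mkₐ_eq_iff]
      refine R.ideal_succ_le N ?_
      rw [← mkₐ_eq_iff]
      exact (ha (N + 1)).trans hp.symm
    -- `a N` and `a (N + 1)` have the same image under `φ_N`, so they agree even modulo `𝔪^{N+1}`.
    have hcauchy : ∀ N, a N ≡ a (N + 1) [SMOD (m ^ N • ⊤ : Submodule A A)] := by
      intro N
      rw [SModEq.sub_mem, smul_eq_mul, Ideal.mul_top]
      refine Ideal.pow_le_pow_right (Nat.le_succ N)
        (mem_pow_of_versalHom_eq_zero hk R hx.d1_eq_zero hx N _ ?_)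
      rw [map_sub, ha, hsucc, sub_self]
    refine ⟨AdicCompletion.mk m A (AdicCompletion.AdicCauchySequence.mk m A a hcauchy), ?_⟩
    refine Subtype.ext (funext fun N => ?_)
    rw [completionHom_apply, AdicCompletion.evalₐ_mk, truncHom_mk]
    exact hsucc N

/-- The formal algebra is the `𝔪`-adic completion. -/
def formalAlgebraEquiv (hx : IsExtBasis k A (A ⧸ m) x) :
    R.formalAlgebra ≃ₐ[k] AdicCompletion m A :=
  (AlgEquiv.ofBijective _ (completionHom_bijective hk R hx)).symm

/-- As `A/𝔪` is one-dimensional, `Ĥ ⊗ A/𝔪` is free of rank one. -/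
def moduleCompletionEquiv : moduleCompletion R ≃ₐ[k] (R.formalAlgebra)ᵐᵒᵖ :=
  let e : (R.formalAlgebra ⊗[k] (A ⧸ m)) ≃ₗ[R.formalAlgebra] R.formalAlgebra :=
    (TensorProduct.AlgebraTensorModule.congr (LinearEquiv.refl _ _)
      (residue hk).toLinearEquiv).trans (TensorProduct.AlgebraTensorModule.rid k _ _)
  -- Endomorphisms of the left regular module are right multiplications, whence the opposite
  -- algebra.
  (e.conjAlgEquiv k).trans (AlgEquiv.moduleEndSelf k).symm

end Completion

end Hochschild

end

theorem mainTheorem3 {k A : Type*} [Field k] [CommRing A] [Algebra k A]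
    (m : Ideal A) (hm : m.IsMaximal)
    (hk : Function.Bijective (algebraMap k (A ⧸ m)))
    (hfin : FiniteDimensional k (Hochschild.Ext1 k A (A ⧸ m))) :
    (∃ (n : ℕ) (x : Fin n → Hochschild.C1 k A (A ⧸ m)), Hochschild.IsExtBasis k A (A ⧸ m) x) ∧
    ∀ (n : ℕ) (x : Fin n → Hochschild.C1 k A (A ⧸ m)), Hochschild.IsExtBasis k A (A ⧸ m) x →
      Nonempty (GMMPAlgebra.MasseyData (Hochschild.gmmp k A (A ⧸ m)) x) ∧
      ∀ R : GMMPAlgebra.MasseyData (Hochschild.gmmp k A (A ⧸ m)) x,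
        Nonempty (moduleCompletion R ≃ₐ[k] AdicCompletion m A) ∧
        Nonempty (R.formalAlgebra ≃ₐ[k] AdicCompletion m A) := by
  refine ⟨Hochschild.exists_isExtBasis k A (A ⧸ m), fun n x hx =>
    ⟨GMMPAlgebra.nonempty_masseyData _ x, fun R => ⟨⟨?_⟩, ⟨?_⟩⟩⟩⟩
  -- The opposite can be dropped because the `𝔪`-adic completion is commutative.
  · exact ((Hochschild.moduleCompletionEquiv hk R).trans
      (Hochschild.formalAlgebraEquiv hk R hx).op).trans (AlgEquiv.toOpposite k _).symm
  · exact Hochschild.formalAlgebraEquiv hk R hx
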